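/- Let $(M,g)$ be a smooth five-dimensional Lorentzian manifold, of signature $(-,+,+,+,+)$, with Levi-Civita connection $\nabla$. The metric is extended complex-bilinearly to $\mathbb{C}\otimes TM$, and $\perp$ is taken with respect to this extension. Let $(N,K)$ be an (integrable) optical structure on $M$, that is: - $N\subset \mathbb{C}\otimes TM$ is a smooth complex subbundle of rank $2$ which is totally null, $N\subset N^\perp$; - $N\cap\overline{N}$ has complex dimension $1$ at every point, and $K\subset TM$ is the real null line bundle with $\mathbb{C}\otimes K=N\cap\overline N$; - both $N$ and $N^\perp$ are integrable in the sense of Frobenius, i.e. $[\Gamma(N),\Gamma(N)]\subset\Gamma(N)$ and $[\Gamma(N^\perp),\Gamma(N^\perp)]\subset\Gamma(N^\perp)$. Define the Riemann tensor by $R_{abd}{}^{c}V^d=2\nabla_{[a}\nabla_{b]}V^c$, the Ricci tensor by $R_{bd}=R_{abd}{}^{a}$, and the scalar curvature by $R=g^{ab}R_{ab}$. The Rho tensor is $P_{ab}=\tfrac13\left(R_{ab}-\tfrac18 R\,g_{ab}\right)$, the Weyl tensor is $C_{abcd}=R_{abcd}+4g_{[a|[c}P_{d]|b]}$, and the Cotton–York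 tensor is $A_{abc}=2\nabla_{[b}P_{c]a}$. All tensors are extended complex-multilinearly. Suppose that the Weyl tensor is algebraically special relative to $N$, i.e. $C(X,Y,Z,\cdot)=0$ for all $X,Y\in N^\perp$ and $Z\in N$. Then $$A(Z,X,Y)=0\qquad\text{for all } X,Y\in N^\perp,\ Z\in N .$$ -/

import Mathlib

open scoped Manifold ContDiff TensorProduct

noncomputable section

/-- The coordinate space `ℝ⁵`. -/
abbrev R5 : Type := EuclideanSpace ℝ (Fin 5)

/-! ### Coordinate curvature of a metric on an open subset of `ℝ⁵`

`G p` is the matrix `(g_{ab})` of metric components at the point `p`. -/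

namespace Coord

/-- The partial derivative `∂_a f`. -/
def pd (a : Fin 5) (f : R5 → ℝ) (p : R5) : ℝ :=
  fderiv ℝ f p (EuclideanSpace.single a 1)

variable (G : R5 → Matrix (Fin 5) (Fin 5) ℝ)

/-- The Christoffel symbols `Γ^c_{ab}` of the Levi-Civita connection. -/
def christoffel (c a b : Fin 5) (p : R5) : ℝ :=
  1 / 2 * ∑ d, (G p)⁻¹ c d *
    (pd a (fun q => G q b d) p + pd b (fun q => G q a d) p - pd d (fun q => G q a b) p)

/-- The Riemann curvature `R_{abd}{}^c`, defined by
`R_{abd}{}^c V^d = (∇_a ∇_b - ∇_b ∇_a) V^c`. -/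
def riemannUp (a b d c : Fin 5) (p : R5) : ℝ :=
  pd a (christoffel G c b d) p - pd b (christoffel G c a d) p
    + ∑ e, (christoffel G c a e p * christoffel G e b d p
      - christoffel G c b e p * christoffel G e a d p)

/-- `R_{abcd} = R_{abc}{}^e g_{ed}`. -/
def riemann (a b c d : Fin 5) (p : R5) : ℝ :=
  ∑ e, riemannUp G a b c e p * G p e d

/-- The Ricci tensor `R_{bd} = R_{abd}{}^a`. -/
def ricci (b d : Fin 5) (p : R5) : ℝ :=
  ∑ a, riemannUp G a b d a p

/-- The scalar curvature. -/
def scalar (p : R5) : ℝ :=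
  ∑ a, ∑ b, (G p)⁻¹ a b * ricci G a b p

/-- The Rho (Schouten) tensor in dimension `n = 5`:
`P_{ab} = (1/(n-2)) (R_{ab} - R g_{ab} / (2(n-1)))`. -/
def rho (a b : Fin 5) (p : R5) : ℝ :=
  1 / 3 * (ricci G a b p - scalar G p / 8 * G p a b)

/-- The Weyl tensor, given by `R_{abcd} = C_{abcd} - 4 g_{[a|[c} P_{d]|b]}`. -/
def weyl (a b c d : Fin 5) (p : R5) : ℝ :=
  riemann G a b c d p
    + (G p a c * rho G d b p - G p b c * rho G d a p
      - G p a d * rho G c b p + G p b d * rho G c a p)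

/-- The covariant derivative `∇_b P_{ca}` of the Rho tensor. -/
def nablaRho (b c a : Fin 5) (p : R5) : ℝ :=
  pd b (rho G c a) p
    - ∑ e, (christoffel G e b c p * rho G e a p + christoffel G e b a p * rho G c e p)

/-- The Cotton-York tensor `A_{abc} = 2 ∇_{[b} P_{c]a} = ∇_b P_{ca} - ∇_c P_{ba}`. -/
def cottonYork (a b c : Fin 5) (p : R5) : ℝ :=
  nablaRho G b c a p - nablaRho G c b a p

end Coord

/-- A smooth Lorentzian metric, of signature `(-,+,+,+,+)`, on a `5`-manifold. -/
structure LorentzianMetric (M : Type*) [TopologicalSpace M] [ChartedSpace R5 M]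
    [IsManifold (𝓡 5) ∞ M] where
  /-- the bilinear form on each tangent space -/
  form : ∀ x : M, TangentSpace (𝓡 5) x →L[ℝ] TangentSpace (𝓡 5) x →L[ℝ] ℝ
  symm : ∀ (x : M) (v w : TangentSpace (𝓡 5) x), form x v w = form x w v
  lorentzian : ∀ x : M, ∃ b : Module.Basis (Fin 5) ℝ (TangentSpace (𝓡 5) x),
    ∀ i j, form x (b i) (b j) = if i = j then (if i = 0 then -1 else 1) else 0
  contMDiff : ContMDiff (𝓡 5) ((𝓡 5).prod 𝓘(ℝ, R5 →L[ℝ] R5 →L[ℝ] ℝ)) ∞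
    (fun x => Bundle.TotalSpace.mk' (R5 →L[ℝ] R5 →L[ℝ] ℝ)
      (E := fun x : M => TangentSpace (𝓡 5) x →L[ℝ] TangentSpace (𝓡 5) x →L[ℝ] ℝ) x (form x))

section Complexified

variable {M : Type*} [TopologicalSpace M] [ChartedSpace R5 M]

/-- The complexified tangent space `ℂ ⊗ T_x M`. -/
abbrev CTangent (x : M) : Type := ℂ ⊗[ℝ] (TangentSpace (𝓡 5) x)

/-- Complex conjugation on `ℂ ⊗ T_x M`, the identity on `T_x M`. -/
def conjC (x : M) : CTangent x →ₛₗ[starRingEnd ℂ] CTangent x where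
  toFun := TensorProduct.map Complex.conjAe.toLinearMap
    (LinearMap.id : TangentSpace (𝓡 5) x →ₗ[ℝ] TangentSpace (𝓡 5) x)
  map_add' := map_add _
  map_smul' c v := by
    induction v using TensorProduct.induction_on with
    | zero => simp
    | tmul a v => simp [TensorProduct.smul_tmul']
    | add u v hu hv => simp only [smul_add, map_add, hu, hv]

/-- The real index of a subspace `N` of `ℂ ⊗ T_x M`: the dimension of `N ∩ N̄`. -/
def realIndex {x : M} (N : Submodule ℂ (CTangent x)) : ℕ :=
  Module.finrank ℂ (N ⊓ N.map (conjC x) : Submodule ℂ (CTangent x))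

/-- A complex vector field `re + i im`, i.e. a section of `ℂ ⊗ TM`, through its real and
imaginary parts. -/
structure CVectorField (M : Type*) [TopologicalSpace M] [ChartedSpace R5 M] where
  re : ∀ x : M, TangentSpace (𝓡 5) x
  im : ∀ x : M, TangentSpace (𝓡 5) x

namespace CVectorField

/-- The value `re x + i im x` in `ℂ ⊗ T_x M`. -/
def val (X : CVectorField M) (x : M) : CTangent x :=
  (1 : ℂ) ⊗ₜ[ℝ] X.re x + Complex.I ⊗ₜ[ℝ] X.im x

/-- Smoothness on a set `U`. -/
def SmoothOn [IsManifold (𝓡 5) ∞ M] (X : CVectorField M) (U : Set M) : Prop :=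
  ContMDiffOn (𝓡 5) (𝓡 5).tangent ∞ (fun x => (⟨x, X.re x⟩ : TangentBundle (𝓡 5) M)) U ∧
  ContMDiffOn (𝓡 5) (𝓡 5).tangent ∞ (fun x => (⟨x, X.im x⟩ : TangentBundle (𝓡 5) M)) U

/-- The complex bilinear extension of the Lie bracket. -/
def bracket (X Y : CVectorField M) : CVectorField M where
  re x := VectorField.mlieBracket (𝓡 5) X.re Y.re x - VectorField.mlieBracket (𝓡 5) X.im Y.im x
  im x := VectorField.mlieBracket (𝓡 5) X.re Y.im x + VectorField.mlieBracket (𝓡 5) X.im Y.re x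

end CVectorField

variable [IsManifold (𝓡 5) ∞ M]

/-- `D` is a smooth complex subbundle of rank `2` of `ℂ ⊗ TM`: locally it has a smooth frame. -/
def IsRankTwoSubbundle (D : ∀ x : M, Submodule ℂ (CTangent x)) : Prop :=
  ∀ x₀ : M, ∃ U : Set M, IsOpen U ∧ x₀ ∈ U ∧ ∃ s t : CVectorField M,
    s.SmoothOn U ∧ t.SmoothOn U ∧
    ∀ x ∈ U, LinearIndependent ℂ ![s.val x, t.val x] ∧
      D x = Submodule.span ℂ {s.val x, t.val x}

/-- Frobenius integrability `[Γ(D), Γ(D)] ⊆ Γ(D)`, for smooth sections over open sets. -/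
def IsIntegrable (D : ∀ x : M, Submodule ℂ (CTangent x)) : Prop :=
  ∀ U : Set M, IsOpen U → ∀ X Y : CVectorField M, X.SmoothOn U → Y.SmoothOn U →
    (∀ x ∈ U, X.val x ∈ D x) → (∀ x ∈ U, Y.val x ∈ D x) →
    ∀ x ∈ U, (X.bracket Y).val x ∈ D x

namespace LorentzianMetric

variable (g : LorentzianMetric M)

/-- The complex bilinear extension of the metric to `ℂ ⊗ T_x M`. -/
def formC (x : M) : LinearMap.BilinForm ℂ (CTangent x) :=
  LinearMap.BilinForm.baseChange ℂ
    (LinearMap.mk₂ ℝ (fun v w : TangentSpace (𝓡 5) x => g.form x v w)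
      (by intros; simp) (by intros; simp) (by intros; simp) (by intros; simp))

/-- The orthogonal complement `D^⊥` with respect to the complexified metric. -/
def perp (D : ∀ x : M, Submodule ℂ (CTangent x)) (x : M) : Submodule ℂ (CTangent x) :=
  (g.formC x).orthogonal (D x)

/-- An almost null structure: a complex subbundle `N ⊆ N^⊥` of maximal rank `2`. -/
structure IsAlmostNullStructure (N : ∀ x : M, Submodule ℂ (CTangent x)) : Prop where
  subbundle : IsRankTwoSubbundle N
  totallyNull : ∀ x, N x ≤ g.perp N x

/-- An almost optical structure `(N, K)`: an almost null structure of real index `1`, with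
`N ∩ N̄ = ℂ ⊗ K`. -/
structure IsAlmostOpticalStructure (N : ∀ x : M, Submodule ℂ (CTangent x))
    (K : ∀ x : M, Submodule ℝ (TangentSpace (𝓡 5) x)) : Prop where
  almostNull : g.IsAlmostNullStructure N
  realIndex_eq_one : ∀ x, realIndex (N x) = 1
  inf_conj : ∀ x, N x ⊓ (N x).map (conjC x) = (K x).baseChange ℂ

/-- An (integrable) optical structure: both `N` and `N^⊥` are integrable. -/
structure IsOpticalStructure (N : ∀ x : M, Submodule ℂ (CTangent x))
    (K : ∀ x : M, Submodule ℝ (TangentSpace (𝓡 5) x)) : Prop where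
  almostOptical : g.IsAlmostOpticalStructure N K
  integrable : IsIntegrable N
  integrable_perp : IsIntegrable (g.perp N)

/-- The metric components `g_{ij} = g(∂_i, ∂_j)` in a chart `e`. -/
def coordMatrix (e : OpenPartialHomeomorph M R5) (p : R5) : Matrix (Fin 5) (Fin 5) ℝ :=
  Matrix.of fun i j =>
    g.form (e.symm p)
      (mfderiv (𝓡 5) (𝓡 5) e.symm p (EuclideanSpace.single i (1 : ℝ) : R5))
      (mfderiv (𝓡 5) (𝓡 5) e.symm p (EuclideanSpace.single j (1 : ℝ) : R5))

end LorentzianMetric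

/-- The complex linear extension to `ℂ ⊗ T_x M` of the coordinate differential `dx^i` of the
chart `e`; its value at `X` is the component `X^i`. -/
def dcoordC (e : OpenPartialHomeomorph M R5) (x : M) (i : Fin 5) : CTangent x →ₗ[ℂ] ℂ :=
  (TensorProduct.AlgebraTensorModule.rid ℝ ℂ ℂ).toLinearMap ∘ₗ
    LinearMap.baseChange ℂ
      ((EuclideanSpace.proj i : R5 →L[ℝ] ℝ).toLinearMap ∘ₗ
        (mfderiv (𝓡 5) (𝓡 5) e x : TangentSpace (𝓡 5) x →L[ℝ] R5).toLinearMap)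

namespace LorentzianMetric

variable (g : LorentzianMetric M)

/-- `C(X, Y, Z, W) = C_{abcd} X^a Y^b Z^c W^d` computed in the chart `e` around `x`. -/
def weylC (e : OpenPartialHomeomorph M R5) (x : M) (X Y Z W : CTangent x) : ℂ :=
  ∑ a, ∑ b, ∑ c, ∑ d, (Coord.weyl (g.coordMatrix e) a b c d (e x) : ℂ) *
    (dcoordC e x a X * dcoordC e x b Y * dcoordC e x c Z * dcoordC e x d W)

/-- `A(X, Y, Z) = A_{abc} X^a Y^b Z^c` computed in the chart `e` around `x`. -/
def cottonYorkC (e : OpenPartialHomeomorph M R5) (x : M) (X Y Z : CTangent x) : ℂ :=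
  ∑ a, ∑ b, ∑ c, (Coord.cottonYork (g.coordMatrix e) a b c (e x) : ℂ) *
    (dcoordC e x a X * dcoordC e x b Y * dcoordC e x c Z)

/-- The Weyl tensor is algebraically special relative to `N`: `C(X, Y, Z, ·) = 0` for all
`X, Y` in `N^⊥` and `Z` in `N`. As for any tensor equation, this is expressed by components
in the charts of the smooth structure. -/
def IsAlgebraicallySpecial (N : ∀ x : M, Submodule ℂ (CTangent x)) : Prop :=
  ∀ e ∈ IsManifold.maximalAtlas (𝓡 5) ∞ M, ∀ x ∈ e.source,
    ∀ X ∈ g.perp N x, ∀ Y ∈ g.perp N x, ∀ Z ∈ N x, ∀ W : CTangent x,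
      g.weylC e x X Y Z W = 0

end LorentzianMetric

end Complexified

end

/-! Near a point, choose a frame s, t of N and a non-null section u of N^⊥. Then s, t, u span N^⊥,
and N is the part of N^⊥ orthogonal to u. All pairings among s, t, u other than g(u,u) vanish
identically, so the Koszul formula turns the involutivity of N and N^⊥ into statements about the
connection on the frame: ∇ of s or t along s or t stays in N, while ∇ of u along s or t, and ∇ of s
or t along u, stay in N^⊥ (`IsNullFrame.conn_mem`).

Write C for the Weyl tensor, P for the Rho tensor and A for the Cotton tensor. Since g is parallel,
the second Bianchi identity becomes an identity between the cyclic sum of ∇C and terms of the form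
g·A (`nablaWeyl_cyclic`). Two choices of arguments isolate what is needed, with e and b in {s, t}
and a arbitrary: (u, s, t; u, e) leaves only -g(u,u) A(e,s,t); (a, b, u; s, t) leaves only g(a,t)
A(s,b,u) - g(a,s) A(t,b,u). In both cases every term of ∇C vanishes. Besides C(N^⊥, N^⊥, N, ·) = 0,
the first Bianchi identity gives C(N, N, N^⊥, ·) = 0. The rules for ∇ keep the arguments within one
of these two patterns, and the derivatives about which nothing is known fall into the free slot.
This is `IsNullFrame.cotton_eq_zero`. Taking a dual to s or to t separates the two terms of the
second relation.

The computation is formal, so it is done in a `LeviCivitaAlgebra`, over an arbitrary ring of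
functions. It is then applied to the smooth complex functions on an open subset of a chart, where
complex vector fields are tuples of functions (`CoordMetric.leviCivita`, `IsMetricOn.coordMetric`).
Evaluation at a point (`cottonYorkC_frame`) and linear algebra in N^⊥
(`cottonYorkC_eq_zero_of_span`) give the result. -/

set_option linter.unusedSectionVars false

noncomputable section

/-! ### Formal calculus of a torsion-free metric connection -/

/-- An algebraic model of a metric with its Levi-Civita connection: `A` plays the role of the
functions and `V` that of the vector fields; the Lie bracket is `∇_X Y - ∇_Y X`. -/
structure LeviCivitaAlgebra (A V : Type*) [CommRing A] [AddCommGroup V] [Module A V] where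
  /-- the derivative of a function along a vector field -/
  der : V →+ A →+ A
  /-- the covariant derivative of a vector field along a vector field -/
  conn : V →+ V →+ V
  /-- the metric -/
  form : LinearMap.BilinForm A V
  der_smul : ∀ (f : A) (X : V) (h : A), der (f • X) h = f * der X h
  der_mul : ∀ (X : V) (f h : A), der X (f * h) = f * der X h + der X f * h
  conn_smul_left : ∀ (f : A) (X Y : V), conn (f • X) Y = f • conn X Y
  conn_smul_right : ∀ (f : A) (X Y : V), conn X (f • Y) = f • conn X Y + der X f • Y
  form_symm : ∀ X Y : V, form X Y = form Y X
  der_form : ∀ X Y Z : V, der X (form Y Z) = form (conn X Y) Z + form Y (conn X Z)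
  der_bracket : ∀ (X Y : V) (f : A),
    der (conn X Y - conn Y X) f = der X (der Y f) - der Y (der X f)
  jacobi : ∀ X Y Z : V,
    (conn X (conn Y Z - conn Z Y) - conn (conn Y Z - conn Z Y) X) +
    (conn Y (conn Z X - conn X Z) - conn (conn Z X - conn X Z) Y) +
    (conn Z (conn X Y - conn Y X) - conn (conn X Y - conn Y X) Z) = 0
  -- Replaces division by 2 in the pair symmetry of the curvature and in the Koszul argument.
  two_cancel : ∀ a : A, 2 * a = 0 → a = 0

namespace LeviCivitaAlgebra

variable {A V : Type*} [CommRing A] [AddCommGroup V] [Module A V] (L : LeviCivitaAlgebra A V)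

/-- The Lie bracket of vector fields. -/
def bracket (X Y : V) : V := L.conn X Y - L.conn Y X

/-- The curvature `R(X, Y) Z`. -/
def curv (X Y Z : V) : V :=
  L.conn X (L.conn Y Z) - L.conn Y (L.conn X Z) - L.conn (L.bracket X Y) Z

/-- The covariant Riemann tensor `g(R(X, Y) Z, W)`. -/
def riem (X Y Z W : V) : A := L.form (L.curv X Y Z) W

lemma curv_swap (X Y Z : V) : L.curv X Y Z = - L.curv Y X Z := by
  simp only [curv, bracket, map_sub, AddMonoidHom.sub_apply]; abel

/-- First Bianchi identity: for a torsion-free connection it is the Jacobi identity written out. -/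
lemma curv_cyclic (X Y Z : V) : L.curv X Y Z + L.curv Y Z X + L.curv Z X Y = 0 := by
  rw [← L.jacobi X Y Z]
  simp only [curv, bracket, map_sub, AddMonoidHom.sub_apply]; abel

lemma curv_add_left (X X' Y Z : V) : L.curv (X + X') Y Z = L.curv X Y Z + L.curv X' Y Z := by
  simp only [curv, bracket, map_sub, map_add, AddMonoidHom.sub_apply, AddMonoidHom.add_apply]; abel

lemma curv_add_mid (X Y Y' Z : V) : L.curv X (Y + Y') Z = L.curv X Y Z + L.curv X Y' Z := by
  simp only [curv, bracket, map_sub, map_add, AddMonoidHom.sub_apply, AddMonoidHom.add_apply]; abel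

lemma curv_add_right (X Y Z Z' : V) : L.curv X Y (Z + Z') = L.curv X Y Z + L.curv X Y Z' := by
  simp only [curv, bracket, map_sub, map_add, AddMonoidHom.sub_apply]; abel

lemma curv_smul_left (f : A) (X Y Z : V) : L.curv (f • X) Y Z = f • L.curv X Y Z := by
  simp only [curv, bracket, map_sub, AddMonoidHom.sub_apply, map_add, AddMonoidHom.add_apply,
    conn_smul_left, conn_smul_right, smul_sub]
  abel

lemma curv_smul_mid (f : A) (X Y Z : V) : L.curv X (f • Y) Z = f • L.curv X Y Z := by
  rw [curv_swap, curv_smul_left, curv_swap L Y X, smul_neg, neg_neg]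

lemma curv_smul_right (f : A) (X Y Z : V) : L.curv X Y (f • Z) = f • L.curv X Y Z := by
  simp only [curv, bracket, conn_smul_right, L.der_bracket, map_add, smul_sub, sub_smul]
  abel

/-- The second Bianchi identity. -/
lemma curv_bianchi (X Y Z W : V) :
    (L.conn X (L.curv Y Z W) - L.curv (L.conn X Y) Z W - L.curv Y (L.conn X Z) W
      - L.curv Y Z (L.conn X W)) +
    (L.conn Y (L.curv Z X W) - L.curv (L.conn Y Z) X W - L.curv Z (L.conn Y X) W
      - L.curv Z X (L.conn Y W)) +
    (L.conn Z (L.curv X Y W) - L.curv (L.conn Z X) Y W - L.curv X (L.conn Z Y) W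
      - L.curv X Y (L.conn Z W)) = 0 := by
  -- Commutators of the operators ∇_X satisfy the Jacobi identity automatically. What remains of the
  -- cyclic sum is minus the derivative of W along the Jacobi sum of X, Y, Z.
  have h := congrArg (fun T => L.conn T W) (L.jacobi X Y Z)
  simp only [map_zero, AddMonoidHom.zero_apply] at h
  rw [← neg_zero, ← h]
  simp only [curv, bracket, map_sub, map_add, AddMonoidHom.sub_apply, AddMonoidHom.add_apply]; abel

lemma riem_swap_left (X Y Z W : V) : L.riem X Y Z W = - L.riem Y X Z W := by
  rw [riem, curv_swap, map_neg, LinearMap.neg_apply, riem]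

lemma riem_cyclic (X Y Z W : V) : L.riem X Y Z W + L.riem Y Z X W + L.riem Z X Y W = 0 := by
  simp only [riem, ← LinearMap.add_apply, ← map_add, curv_cyclic, map_zero, LinearMap.zero_apply]

/-- Metric compatibility: apply [X, Y] = XY - YX to the function g(Z, W). -/
lemma riem_swap_right (X Y Z W : V) : L.riem X Y Z W = - L.riem X Y W Z := by
  have h := L.der_bracket X Y (L.form Z W)
  simp only [der_form, map_add] at h
  simp only [riem, curv, bracket, map_sub, LinearMap.sub_apply]
  simp only [L.form_symm _ Z]
  simp only [map_sub, LinearMap.sub_apply, AddMonoidHom.sub_apply] at h ⊢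
  linear_combination -h

/-- The usual octahedron argument: four instances of the cyclic identity, combined through the two
antisymmetries, yield twice the difference of the two sides. -/
lemma riem_pair (X Y Z W : V) : L.riem X Y Z W = L.riem Z W X Y := by
  rw [← sub_eq_zero]
  apply L.two_cancel
  have h1 := L.riem_cyclic X Y Z W
  have h2 := L.riem_cyclic Y Z W X
  have h3 := L.riem_cyclic Z W X Y
  have h4 := L.riem_cyclic W X Y Z
  linear_combination h1 + h2 - h3 - h4 - L.riem_swap_right Y Z W X - L.riem_swap_right Z W Y X
    - L.riem_swap_left W Y Z X + L.riem_swap_right Y W Z X + L.riem_swap_right W X Y Z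
    + L.riem_swap_right X Y W Z + L.riem_swap_left X Z W Y - L.riem_swap_right Z X W Y

/-- The covariant derivative of the Riemann tensor. -/
def nablaRiem (U X Y Z W : V) : A :=
  L.der U (L.riem X Y Z W) - L.riem (L.conn U X) Y Z W - L.riem X (L.conn U Y) Z W
    - L.riem X Y (L.conn U Z) W - L.riem X Y Z (L.conn U W)

lemma nablaRiem_cyclic (X Y Z W U : V) :
    L.nablaRiem X Y Z W U + L.nablaRiem Y Z X W U + L.nablaRiem Z X Y W U = 0 := by
  have h := congrArg (fun T => L.form T U) (L.curv_bianchi X Y Z W)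
  simp only [map_add, map_sub, LinearMap.add_apply, LinearMap.sub_apply, map_zero,
    LinearMap.zero_apply] at h
  simp only [nablaRiem, riem, der_form]
  linear_combination h

variable (P : LinearMap.BilinForm A V)

/-- The Riemann tensor corrected by the Kulkarni-Nomizu product of the metric with `P`; it is the
Weyl tensor if `P` is the Schouten tensor. -/
def weyl (X Y Z W : V) : A :=
  L.riem X Y Z W + (L.form X Z * P W Y - L.form Y Z * P W X - L.form X W * P Z Y
    + L.form Y W * P Z X)

/-- The covariant derivative of a bilinear form. -/
def nablaForm (X Y Z : V) : A := L.der X (P Y Z) - P (L.conn X Y) Z - P Y (L.conn X Z)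

/-- The Cotton tensor `A(X, Y, Z) = (∇_Y P)(Z, X) - (∇_Z P)(Y, X)`. -/
def cotton (X Y Z : V) : A := L.nablaForm P Y Z X - L.nablaForm P Z Y X

/-- The covariant derivative of `weyl`. -/
def nablaWeyl (U X Y Z W : V) : A :=
  L.der U (L.weyl P X Y Z W) - L.weyl P (L.conn U X) Y Z W - L.weyl P X (L.conn U Y) Z W
    - L.weyl P X Y (L.conn U Z) W - L.weyl P X Y Z (L.conn U W)

/-- Since g is parallel, differentiating the correction term only differentiates `P`. -/
lemma nablaWeyl_eq (U X Y Z W : V) : L.nablaWeyl P U X Y Z W = L.nablaRiem U X Y Z W +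
    (L.form X Z * L.nablaForm P U W Y - L.form Y Z * L.nablaForm P U W X
      - L.form X W * L.nablaForm P U Z Y + L.form Y W * L.nablaForm P U Z X) := by
  simp only [nablaWeyl, nablaRiem, nablaForm, weyl, map_add, map_sub, der_mul, der_form]
  ring

variable {P}

lemma nablaForm_symm (hP : ∀ X Y, P X Y = P Y X) (X Y Z : V) :
    L.nablaForm P X Y Z = L.nablaForm P X Z Y := by
  simp only [nablaForm, hP Y, hP _ Z]; ring

/-- The Bianchi identity for the Weyl tensor. -/
lemma nablaWeyl_cyclic (hP : ∀ X Y, P X Y = P Y X) (X Y Z W U : V) :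
    L.nablaWeyl P X Y Z W U + L.nablaWeyl P Y Z X W U + L.nablaWeyl P Z X Y W U =
      L.form X U * L.cotton P W Y Z + L.form Y U * L.cotton P W Z X + L.form Z U * L.cotton P W X Y
      - L.form X W * L.cotton P U Y Z - L.form Y W * L.cotton P U Z X
      - L.form Z W * L.cotton P U X Y := by
  have h := L.nablaRiem_cyclic X Y Z W U
  simp only [nablaWeyl_eq, cotton, L.nablaForm_symm hP _ W, L.nablaForm_symm hP _ U]
  linear_combination h

lemma weyl_swap_left (X Y Z W : V) : L.weyl P X Y Z W = - L.weyl P Y X Z W := by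
  rw [weyl, riem_swap_left, weyl]; ring

lemma weyl_swap_right (X Y Z W : V) : L.weyl P X Y Z W = - L.weyl P X Y W Z := by
  rw [weyl, riem_swap_right, weyl]; ring

lemma weyl_pair (hP : ∀ X Y, P X Y = P Y X) (X Y Z W : V) :
    L.weyl P X Y Z W = L.weyl P Z W X Y := by
  rw [weyl, riem_pair, weyl, L.form_symm X Z, L.form_symm Y Z, L.form_symm X W, L.form_symm Y W,
    hP W Y, hP W X, hP Z Y, hP Z X]; ring

lemma weyl_cyclic (hP : ∀ X Y, P X Y = P Y X) (X Y Z W : V) :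
    L.weyl P X Y Z W + L.weyl P Y Z X W + L.weyl P Z X Y W = 0 := by
  have h := L.riem_cyclic X Y Z W
  simp only [weyl, L.form_symm Y X, L.form_symm Z X, L.form_symm Z Y, hP Y X, hP Z X, hP Z Y]
  linear_combination h

/-! ### Null frames and the vanishing of the Cotton tensor -/

/-- `X` is orthogonal to `s` and `t`. -/
def InPerp (s t X : V) : Prop := L.form X s = 0 ∧ L.form X t = 0

/-- `X` is orthogonal to `s`, `t` and `u`. -/
def InNull (s t u X : V) : Prop := L.InPerp s t X ∧ L.form X u = 0

/-- A local frame `s, t` of a totally null distribution `N` and a section `u` of `N^⊥`, where both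
`N` and `N^⊥` are involutive. -/
structure IsNullFrame (s t u : V) : Prop where
  null_left : L.InNull s t u s
  null_right : L.InNull s t u t
  perp : L.InPerp s t u
  bracket_null : L.InNull s t u (L.bracket s t)
  bracket_left : L.InPerp s t (L.bracket s u)
  bracket_right : L.InPerp s t (L.bracket t u)

namespace IsNullFrame

variable {L} {s t u : V} (h : L.IsNullFrame s t u)
include h

/-- By compatibility, g(∇_X Y, Z) is antisymmetric in Y, Z whenever g(Y, Z) = 0. By involutivity,
the brackets drop out and it is symmetric in X, Y for the pairings considered. The Koszul formula
then kills every listed component. Nothing is claimed about ∇_u u. -/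
lemma conn_mem : (L.InNull s t u (L.conn s s) ∧ L.InNull s t u (L.conn s t) ∧
    L.InNull s t u (L.conn t s) ∧ L.InNull s t u (L.conn t t)) ∧
    (L.InPerp s t (L.conn s u) ∧ L.InPerp s t (L.conn t u) ∧
    L.InPerp s t (L.conn u s) ∧ L.InPerp s t (L.conn u t)) := by
  obtain ⟨⟨⟨ss, st⟩, su⟩, ⟨⟨-, tt⟩, tu⟩, -, ⟨⟨b1, b2⟩, b3⟩, ⟨b4, b5⟩, b6, b7⟩ := h
  have key : ∀ X Y Z : V, L.form Y Z = 0 → L.form (L.conn X Y) Z + L.form (L.conn X Z) Y = 0 := by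
    intro X Y Z h0
    have := L.der_form X Y Z
    rw [h0, map_zero, L.form_symm Y] at this
    exact this.symm
  have key0 : ∀ X Y : V, L.form Y Y = 0 → L.form (L.conn X Y) Y = 0 := fun X Y h0 =>
    L.two_cancel _ (by linear_combination key X Y Y h0)
  simp only [bracket, map_sub, LinearMap.sub_apply] at b1 b2 b3 b4 b5 b6 b7
  have k1 := key s s t st
  have k2 := key t s t st
  have k3 := key u s t st
  have k4 := key s s u su
  have k5 := key s t u tu
  have k6 := key t s u su
  have k7 := key t t u tu
  have sss := key0 s s ss
  have tss := key0 t s ss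
  have uss := key0 u s ss
  have stt := key0 s t tt
  have ttt := key0 t t tt
  have utt := key0 u t tt
  have sts : L.form (L.conn s t) s = 0 := by linear_combination b1 + tss
  have tst : L.form (L.conn t s) t = 0 := by linear_combination stt - b2
  have sus : L.form (L.conn s u) s = 0 := by linear_combination b4 + uss
  have tut : L.form (L.conn t u) t = 0 := by linear_combination b7 + utt
  -- Alternating the two symmetries through all three pairs of fields carries g(∇_u s, t) to its own
  -- negative.
  have ust : L.form (L.conn u s) t = 0 :=
    L.two_cancel _ (by linear_combination k3 - b5 + k5 - b3 - k6 + b6)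
  have uts : L.form (L.conn u t) s = 0 := by linear_combination k3 - ust
  refine ⟨⟨⟨⟨sss, ?_⟩, ?_⟩, ⟨⟨sts, stt⟩, ?_⟩, ⟨⟨tss, tst⟩, ?_⟩, ⟨?_, ttt⟩, ?_⟩,
    ⟨sus, ?_⟩, ⟨?_, tut⟩, ⟨uss, ust⟩, uts, utt⟩
  · linear_combination k1 - sts
  · linear_combination k4 - sus
  · linear_combination k5 - b5 - ust
  · linear_combination k6 - b6 - uts
  · linear_combination k2 - tst
  · linear_combination k7 - tut
  · linear_combination b5 + ust
  · linear_combination b6 + uts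

variable {P : LinearMap.BilinForm A V} (hP : ∀ X Y, P X Y = P Y X)
  (hC : ∀ X Y Z W, L.InPerp s t X → L.InPerp s t Y → L.InNull s t u Z → L.weyl P X Y Z W = 0)
include hP hC

/-- If the Weyl tensor is algebraically special, then the Cotton tensor vanishes on `N ⊗ Λ²N^⊥`:
the algebraic core of the theorem. -/
theorem cotton_eq_zero :
    (∀ e, e = s ∨ e = t → L.form u u * L.cotton P e s t = 0) ∧
    ∀ a b, b = s ∨ b = t → L.form a t * L.cotton P s b u = L.form a s * L.cotton P t b u := by
  have w1 := hC
  have w1r : ∀ X Y Z W, L.InPerp s t X → L.InPerp s t Y → L.InNull s t u Z →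
      L.weyl P X Y W Z = 0 := fun X Y Z W hX hY hZ => by
    rw [weyl_swap_right, hC X Y Z W hX hY hZ, neg_zero]
  have w1p : ∀ X Y Z W, L.InPerp s t X → L.InPerp s t Y → L.InNull s t u Z →
      L.weyl P W Z X Y = 0 := fun X Y Z W hX hY hZ => by
    rw [L.weyl_pair hP, w1r X Y Z W hX hY hZ]
  -- In the cyclic identity on Z, Z', X, the other two terms have both leading arguments in N^⊥ and
  -- the third in N, so they vanish by hypothesis.
  have w2 : ∀ Z Z' X W, L.InNull s t u Z → L.InNull s t u Z' → L.InPerp s t X →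
      L.weyl P Z Z' X W = 0 := fun Z Z' X W hZ hZ' hX => by
    have := L.weyl_cyclic hP Z Z' X W
    rwa [hC Z' X Z W hZ'.1 hX hZ, hC X Z Z' W hX hZ.1 hZ', add_zero, add_zero] at this
  have w2p : ∀ Z Z' X W, L.InNull s t u Z → L.InNull s t u Z' → L.InPerp s t X →
      L.weyl P X W Z Z' = 0 := fun Z Z' X W hZ hZ' hX => by
    rw [L.weyl_pair hP, w2 Z Z' X W hZ hZ' hX]
  have w2q : ∀ Z Z' X W, L.InNull s t u Z → L.InNull s t u Z' → L.InPerp s t X →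
      L.weyl P W X Z Z' = 0 := fun Z Z' X W hZ hZ' hX => by
    rw [weyl_swap_left, w2p Z Z' X W hZ hZ' hX, neg_zero]
  obtain ⟨⟨nss, nst, nts, ntt⟩, psu, ptu, pus, put⟩ := h.conn_mem
  have hs := h.null_left
  have ht := h.null_right
  have hu := h.perp
  constructor
  · intro e he
    have hen : L.InNull s t u e := by rcases he with rfl | rfl <;> assumption
    have hse : L.InNull s t u (L.conn s e) := by rcases he with rfl | rfl <;> assumption
    have hte : L.InNull s t u (L.conn t e) := by rcases he with rfl | rfl <;> assumption
    have hue : L.InPerp s t (L.conn u e) := by rcases he with rfl | rfl <;> assumption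
    -- As u is orthogonal to N and N is null, only g(u,u) survives on the Cotton side.
    have hb := L.nablaWeyl_cyclic hP u s t u e
    have e0 : L.form u e = 0 := by rw [L.form_symm]; exact hen.2
    have e1 : L.form s e = 0 := by rcases he with rfl | rfl; exacts [hs.1.1, hs.1.2]
    have e2 : L.form t e = 0 := by rcases he with rfl | rfl; exacts [ht.1.1, ht.1.2]
    simp only [e0, e1, e2, hs.2, ht.2, zero_mul, add_zero, sub_zero, zero_sub] at hb
    rw [← neg_eq_zero, ← hb]
    simp only [nablaWeyl]
    -- The derivative ∇_u u sits in the free slot of C(s, t, ·, e). The derivative ∇_u e, known only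
    -- to lie in N^⊥, is harmless because C(s, t, u, ·) vanishes.
    rw [w1r s t e u hs.1 ht.1 hen, w1r _ t e u pus ht.1 hen, w1r s _ e u hs.1 put hen,
      w1r s t e _ hs.1 ht.1 hen, w2 s t u _ hs ht hu,
      w1r t u e u ht.1 hu hen, w1r _ u e u nst.1 hu hen, w1r t _ e u ht.1 psu hen,
      w1r t u e _ ht.1 hu hen, w1r t u _ u ht.1 hu hse,
      w1r u s e u hu hs.1 hen, w1r _ s e u ptu hs.1 hen, w1r u _ e u hu nts.1 hen,
      w1r u s e _ hu hs.1 hen, w1r u s _ u hu hs.1 hte]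
    simp
  · intro a b hb
    have hbn : L.InNull s t u b := by rcases hb with rfl | rfl <;> assumption
    have hbs : L.InNull s t u (L.conn b s) := by rcases hb with rfl | rfl <;> assumption
    have hbt : L.InNull s t u (L.conn b t) := by rcases hb with rfl | rfl <;> assumption
    have hbu : L.InPerp s t (L.conn b u) := by rcases hb with rfl | rfl <;> assumption
    have hub : L.InPerp s t (L.conn u b) := by rcases hb with rfl | rfl <;> assumption
    -- Only pairings with a survive on the Cotton side. Derivatives along a, and of a, are
    -- uncontrolled, but each takes the one free slot of a vanishing pattern of C.
    have hB := L.nablaWeyl_cyclic hP a b u s t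
    simp only [hbn.1.1, hbn.1.2, hu.1, hu.2, zero_mul, add_zero, sub_zero] at hB
    rw [← sub_eq_zero, ← hB]
    simp only [nablaWeyl]
    rw [w1 b u s t hbn.1 hu hs, w2q s t u _ hs ht hu, w2p s t b _ hs ht hbn.1,
      w1r b u t _ hbn.1 hu ht, w1 b u s _ hbn.1 hu hs,
      w2p s t u _ hs ht hu, w2p s t _ a hs ht hbu, w2p s t u _ hs ht hu,
      w2p _ t u a hbs ht hu, w2p s _ u a hs hbt hu,
      w2q s t b a hs ht hbn.1, w2q s t b _ hs ht hbn.1, w2q s t _ a hs ht hub,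
      w1p _ t b a pus ht.1 hbn, w1p s _ b a hs.1 put hbn]
    simp

end IsNullFrame

end LeviCivitaAlgebra

/-! ### The Levi-Civita connection in coordinates over a ring of functions -/

/-- The components of a metric in coordinates, over a ring `A` of functions with commuting partial
derivatives. -/
structure CoordMetric (ι A : Type*) [Fintype ι] [DecidableEq ι] [CommRing A] where
  /-- the partial derivatives -/
  D : ι → A →+ A
  /-- the components of the metric -/
  G : Matrix ι ι A
  /-- the components of the inverse metric -/
  H : Matrix ι ι A
  /-- the constant `1 / 2` -/
  half : A
  D_mul : ∀ a f h, D a (f * h) = f * D a h + D a f * h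
  D_comm : ∀ a b f, D a (D b f) = D b (D a f)
  G_symm : ∀ a b, G a b = G b a
  H_mul_G : H * G = 1
  two_mul_half : 2 * half = 1

namespace CoordMetric

variable {ι A : Type*} [Fintype ι] [DecidableEq ι] [CommRing A] (S : CoordMetric ι A)

lemma H_symm (a b : ι) : S.H a b = S.H b a := by
  have hG : S.G.transpose = S.G := by ext i j; exact S.G_symm j i
  have h1 : S.G * S.H.transpose = 1 := by
    rw [← hG, ← Matrix.transpose_mul, S.H_mul_G, Matrix.transpose_one]
  have : S.H = S.H.transpose := by
    calc S.H = S.H * (S.G * S.H.transpose) := by rw [h1, mul_one]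
      _ = S.H.transpose := by rw [← mul_assoc, S.H_mul_G, one_mul]
  exact congrFun (congrFun this a) b

lemma sum_G_mul_H (a c : ι) : ∑ b, S.G a b * S.H b c = if a = c then 1 else 0 := by
  have h : S.G * S.H = 1 := mul_eq_one_comm.mp S.H_mul_G
  have := congrFun (congrFun h a) c
  rwa [Matrix.mul_apply, Matrix.one_apply] at this

lemma sum_H_mul_G (a c : ι) : ∑ b, S.H a b * S.G b c = if a = c then 1 else 0 := by
  have := congrFun (congrFun S.H_mul_G a) c
  rwa [Matrix.mul_apply, Matrix.one_apply] at this

/-- The Christoffel symbols `Γ^c_{ab}`. -/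
def christoffel (c a b : ι) : A :=
  S.half * ∑ d, S.H c d * (S.D a (S.G b d) + S.D b (S.G a d) - S.D d (S.G a b))

lemma christoffel_symm (c a b : ι) : S.christoffel c a b = S.christoffel c b a := by
  simp only [christoffel, S.G_symm a b, add_comm (S.D a _)]

lemma sum_christoffel_mul_G (a b e : ι) : ∑ c, S.christoffel c a b * S.G c e =
    S.half * (S.D a (S.G b e) + S.D b (S.G a e) - S.D e (S.G a b)) := by
  simp only [christoffel, mul_assoc, ← Finset.mul_sum, Finset.sum_mul]
  rw [Finset.sum_comm]
  congr 1
  have : ∀ d, ∑ c, S.H c d * ((S.D a (S.G b d) + S.D b (S.G a d) - S.D d (S.G a b)) * S.G c e) =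
      (S.D a (S.G b d) + S.D b (S.G a d) - S.D d (S.G a b)) * if d = e then 1 else 0 := by
    intro d
    rw [← S.sum_H_mul_G, Finset.mul_sum]
    refine Finset.sum_congr rfl fun c _ => ?_
    rw [S.H_symm c d]; ring
  simp [this]

/-- Metric compatibility in components, on which `D_form` rests. -/
lemma D_G (a b c : ι) : S.D a (S.G b c) =
    ∑ e, S.christoffel e a b * S.G e c + ∑ e, S.christoffel e a c * S.G e b := by
  rw [sum_christoffel_mul_G, sum_christoffel_mul_G, S.G_symm c b]
  linear_combination (-S.D a (S.G b c)) * S.two_mul_half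

/-- The derivative along a vector field. -/
def der : (ι → A) →+ A →+ A :=
  AddMonoidHom.mk' (fun X => ∑ a, (AddMonoidHom.mulLeft (X a)).comp (S.D a)) (by
    intro X Y; ext f; simp [add_mul, Finset.sum_add_distrib])

lemma der_apply (X : ι → A) (f : A) : S.der X f = ∑ a, X a * S.D a f := by simp [der]

/-- The Levi-Civita connection. -/
def conn : (ι → A) →+ (ι → A) →+ (ι → A) :=
  AddMonoidHom.mk' (fun X => AddMonoidHom.mk'
    (fun Y c => ∑ a, X a * (S.D a (Y c) + ∑ b, S.christoffel c a b * Y b)) (by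
      intro Y Z; ext c
      simp only [Pi.add_apply, map_add, mul_add, Finset.sum_add_distrib]; abel)) (by
    intro X Y; ext Z c
    simp [add_mul, Finset.sum_add_distrib])

lemma conn_apply (X Y : ι → A) (c : ι) :
    S.conn X Y c = ∑ a, X a * (S.D a (Y c) + ∑ b, S.christoffel c a b * Y b) := rfl

/-- The Christoffel terms cancel by symmetry, so the torsion-free bracket is the coordinate Lie
bracket. Both `der_comm` and the Jacobi identity depend on this. -/
lemma conn_sub_conn (X Y : ι → A) (c : ι) :
    (S.conn X Y - S.conn Y X) c = S.der X (Y c) - S.der Y (X c) := by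
  have : ∑ a, X a * ∑ b, S.christoffel c a b * Y b = ∑ a, Y a * ∑ b, S.christoffel c a b * X b := by
    simp only [Finset.mul_sum]
    rw [Finset.sum_comm]
    refine Finset.sum_congr rfl fun a _ => Finset.sum_congr rfl fun b _ => ?_
    rw [S.christoffel_symm]; ring
  simp only [Pi.sub_apply, conn_apply, der_apply, mul_add, Finset.sum_add_distrib, this]
  ring

lemma D_sum (a : ι) (f : ι → A) : S.D a (∑ i, f i) = ∑ i, S.D a (f i) := map_sum _ _ _

lemma der_comm (X Y : ι → A) (f : A) :
    S.der (S.conn X Y - S.conn Y X) f = S.der X (S.der Y f) - S.der Y (S.der X f) := by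
  rw [der_apply]
  simp only [conn_sub_conn, S.der_apply, D_sum, S.D_mul, sub_mul, Finset.sum_sub_distrib,
    Finset.mul_sum, Finset.sum_mul, mul_add, Finset.sum_add_distrib]
  have : ∑ a, ∑ c, X a * (Y c * S.D a (S.D c f)) = ∑ a, ∑ c, Y a * (X c * S.D a (S.D c f)) := by
    rw [Finset.sum_comm]
    refine Finset.sum_congr rfl fun a _ => Finset.sum_congr rfl fun b _ => ?_
    rw [S.D_comm]; ring
  rw [this, Finset.sum_comm, Finset.sum_comm (f := fun a c => Y c * S.D c (X a) * S.D a f)]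
  simp only [mul_assoc]
  ring

/-- The metric as a bilinear form. -/
def form : LinearMap.BilinForm A (ι → A) := Matrix.toBilin' S.G

lemma form_apply (X Y : ι → A) : S.form X Y = ∑ a, ∑ b, X a * S.G a b * Y b := by
  rw [form, Matrix.toBilin'_apply]

lemma form_symm (X Y : ι → A) : S.form X Y = S.form Y X := by
  rw [form_apply, form_apply, Finset.sum_comm]
  refine Finset.sum_congr rfl fun a _ => Finset.sum_congr rfl fun b _ => ?_
  rw [S.G_symm]; ring

/-- The covariant derivative along a coordinate vector field. -/
def nabla (a : ι) (Y : ι → A) (c : ι) : A := S.D a (Y c) + ∑ b, S.christoffel c a b * Y b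

lemma conn_eq_sum (X Y : ι → A) : S.conn X Y = ∑ a, X a • S.nabla a Y := by
  ext c; simp [conn_apply, nabla]

lemma conn_single (a : ι) (Y : ι → A) : S.conn (Pi.single a 1) Y = S.nabla a Y := by
  simp [conn_eq_sum, Pi.single_apply]

lemma nabla_single (a b c : ι) : S.nabla a (Pi.single b 1) c = S.christoffel c a b := by
  have h1 : S.D a 1 = 0 := by simpa using S.D_mul a 1 1
  have h : S.D a (Pi.single (M := fun _ => A) b 1 c) = 0 := by
    rw [Pi.single_apply]; split_ifs <;> simp [h1]
  rw [nabla, h]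
  simp [Pi.single_apply]

lemma form_nabla (a : ι) (Y Z : ι → A) : S.form (S.nabla a Y) Z =
    ∑ b, ∑ c, (S.D a (Y b) * S.G b c * Z c
      + Y b * (∑ e, S.christoffel e a b * S.G e c) * Z c) := by
  simp only [form_apply, nabla, add_mul, Finset.sum_add_distrib]
  congr 1
  simp only [Finset.sum_mul, Finset.mul_sum]
  rw [Finset.sum_congr rfl fun _ _ => Finset.sum_comm, Finset.sum_comm]
  refine Finset.sum_congr rfl fun b _ => ?_
  rw [Finset.sum_comm]
  exact Finset.sum_congr rfl fun c _ => Finset.sum_congr rfl fun e _ => by ring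

lemma D_form (a : ι) (Y Z : ι → A) :
    S.D a (S.form Y Z) = S.form (S.nabla a Y) Z + S.form Y (S.nabla a Z) := by
  rw [S.form_symm Y (S.nabla a Z), form_nabla, form_nabla,
    Finset.sum_comm (f := fun b c => S.D a (Z b) * S.G b c * Y c + _)]
  simp only [form_apply, D_sum, ← Finset.sum_add_distrib]
  refine Finset.sum_congr rfl fun b _ => Finset.sum_congr rfl fun c _ => ?_
  rw [S.D_mul, S.D_mul, S.D_G a b c, S.G_symm c b]
  ring

lemma der_form (X Y Z : ι → A) :
    S.der X (S.form Y Z) = S.form (S.conn X Y) Z + S.form Y (S.conn X Z) := by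
  simp [der_apply, D_form, conn_eq_sum, mul_add, Finset.sum_add_distrib]

/-- The Levi-Civita connection of a metric in coordinates. -/
def leviCivita : LeviCivitaAlgebra A (ι → A) where
  der := S.der
  conn := S.conn
  form := S.form
  der_smul f X h := by simp [der_apply, Finset.mul_sum, mul_assoc]
  der_mul X f h := by
    simp only [der_apply, S.D_mul, Finset.mul_sum, Finset.sum_mul, ← Finset.sum_add_distrib]
    exact Finset.sum_congr rfl fun a _ => by ring
  conn_smul_left f X Y := by
    ext c; simp [conn_apply, Finset.mul_sum, mul_assoc]
  conn_smul_right f X Y := by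
    ext c
    simp only [conn_apply, Pi.smul_apply, smul_eq_mul, Pi.add_apply, der_apply, S.D_mul,
      Finset.mul_sum, Finset.sum_mul, ← Finset.sum_add_distrib, mul_add]
    refine Finset.sum_congr rfl fun a _ => ?_
    rw [add_right_comm, Finset.sum_congr rfl (fun b _ => show
      X a * (S.christoffel c a b * (f * Y b)) = f * (X a * (S.christoffel c a b * Y b)) by ring)]
    ring
  form_symm := S.form_symm
  der_form := S.der_form
  der_bracket := S.der_comm
  -- Each component of a bracket is a difference of derivatives of components, so the identity
  -- reduces to brackets acting as commutators on functions.
  jacobi X Y Z := by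
    ext c
    simp only [Pi.add_apply, conn_sub_conn, S.der_comm, Pi.zero_apply]
    simp only [map_sub]
    ring
  two_cancel a h := by linear_combination S.half * h - a * S.two_mul_half

/-- The components `R_{abd}{}^c` of the curvature. -/
def riemannUp (a b d c : ι) : A :=
  S.D a (S.christoffel c b d) - S.D b (S.christoffel c a d)
    + ∑ e, (S.christoffel c a e * S.christoffel e b d - S.christoffel c b e * S.christoffel e a d)

/-- The components `R_{abcd}` of the curvature. -/
def riemann (a b c d : ι) : A := ∑ e, S.riemannUp a b c e * S.G e d

/-- The components of the Ricci tensor. -/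
def ricci (b d : ι) : A := ∑ a, S.riemannUp a b d a

/-- Coordinate fields commute, so the bracket term of the curvature disappears. -/
lemma curv_single (a b d c : ι) :
    S.leviCivita.curv (Pi.single a 1) (Pi.single b 1) (Pi.single d 1) c = S.riemannUp a b d c := by
  have h1 : S.leviCivita.bracket (Pi.single a 1) (Pi.single b 1) = 0 := by
    ext c
    simp only [LeviCivitaAlgebra.bracket, leviCivita, Pi.sub_apply, conn_single, nabla_single]
    rw [S.christoffel_symm, sub_self, Pi.zero_apply]
  rw [LeviCivitaAlgebra.curv, h1, map_zero]
  simp only [leviCivita, conn_single, Pi.sub_apply, AddMonoidHom.zero_apply, Pi.zero_apply]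
  rw [nabla.eq_1 S a, nabla.eq_1 S b (S.nabla a _), nabla_single, nabla_single]
  simp only [nabla_single, riemannUp, Finset.sum_sub_distrib]
  ring

lemma form_single_right (X : ι → A) (d : ι) : S.form X (Pi.single d 1) = ∑ e, X e * S.G e d := by
  simp [form_apply, Pi.single_apply]

lemma riem_single (a b c d : ι) : S.leviCivita.riem (Pi.single a 1) (Pi.single b 1)
    (Pi.single c 1) (Pi.single d 1) = S.riemann a b c d := by
  rw [LeviCivitaAlgebra.riem]
  change S.form _ _ = _
  simp only [form_single_right, curv_single, riemann]

lemma riemannUp_eq (a b d c : ι) : S.riemannUp a b d c = ∑ e, S.riemann a b d e * S.H e c := by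
  simp only [riemann, Finset.sum_mul]
  rw [Finset.sum_comm]
  simp [mul_assoc, ← Finset.mul_sum, sum_G_mul_H]

lemma ricci_symm (b d : ι) : S.ricci b d = S.ricci d b := by
  simp only [ricci, riemannUp_eq]
  rw [Finset.sum_comm]
  refine Finset.sum_congr rfl fun a _ => Finset.sum_congr rfl fun e _ => ?_
  rw [S.H_symm a e, ← riem_single, ← riem_single, LeviCivitaAlgebra.riem_pair,
    LeviCivitaAlgebra.riem_swap_left, LeviCivitaAlgebra.riem_swap_right, neg_neg]

lemma isLinearMap_eq_sum {M : Type*} [AddCommGroup M] [Module A M] {f : (ι → A) → M}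
    (hf : IsLinearMap A f) (X : ι → A) : f X = ∑ a, X a • f (Pi.single a 1) := by
  have h : X = ∑ a, X a • (Pi.single a 1 : ι → A) := by
    ext b; simp [Pi.single_apply]
  conv_lhs => rw [h]
  change IsLinearMap.mk' f hf (∑ a, X a • (Pi.single a 1 : ι → A)) = _
  rw [map_sum]
  exact Finset.sum_congr rfl fun a _ => hf.map_smul _ _

/-- A function that is linear in each of three vector fields is given by its components. -/
lemma trilinear_eq_sum {T : (ι → A) → (ι → A) → (ι → A) → A}
    (h1 : ∀ Y Z, IsLinearMap A fun X => T X Y Z) (h2 : ∀ X Z, IsLinearMap A fun Y => T X Y Z)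
    (h3 : ∀ X Y, IsLinearMap A fun Z => T X Y Z) (X Y Z : ι → A) :
    T X Y Z = ∑ a, ∑ b, ∑ c, T (Pi.single a 1) (Pi.single b 1) (Pi.single c 1) *
      (X a * Y b * Z c) := by
  rw [isLinearMap_eq_sum (h1 Y Z)]
  refine Finset.sum_congr rfl fun a _ => ?_
  rw [isLinearMap_eq_sum (h2 _ Z), Finset.smul_sum]
  refine Finset.sum_congr rfl fun b _ => ?_
  rw [isLinearMap_eq_sum (h3 _ _), Finset.smul_sum, Finset.smul_sum]
  refine Finset.sum_congr rfl fun c _ => ?_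
  simp only [smul_eq_mul]
  ring

/-- A function that is linear in each of four vector fields is given by its components. -/
lemma quadrilinear_eq_sum {T : (ι → A) → (ι → A) → (ι → A) → (ι → A) → A}
    (h1 : ∀ Y Z W, IsLinearMap A fun X => T X Y Z W)
    (h2 : ∀ X Z W, IsLinearMap A fun Y => T X Y Z W)
    (h3 : ∀ X Y W, IsLinearMap A fun Z => T X Y Z W)
    (h4 : ∀ X Y Z, IsLinearMap A fun W => T X Y Z W) (X Y Z W : ι → A) :
    T X Y Z W = ∑ a, ∑ b, ∑ c, ∑ d,
      T (Pi.single a 1) (Pi.single b 1) (Pi.single c 1) (Pi.single d 1) *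
        (X a * Y b * Z c * W d) := by
  rw [isLinearMap_eq_sum (h1 Y Z W)]
  refine Finset.sum_congr rfl fun a _ => ?_
  rw [trilinear_eq_sum (h2 _) (h3 _) (h4 _), Finset.smul_sum]
  refine Finset.sum_congr rfl fun b _ => ?_
  rw [Finset.smul_sum]
  refine Finset.sum_congr rfl fun c _ => ?_
  rw [Finset.smul_sum]
  refine Finset.sum_congr rfl fun d _ => ?_
  simp only [smul_eq_mul]
  ring

variable (P : Matrix ι ι A)

/-- The components of the Weyl tensor, if `P` is the Schouten tensor. -/
def weyl (a b c d : ι) : A := S.riemann a b c d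
  + (S.G a c * P d b - S.G b c * P d a - S.G a d * P c b + S.G b d * P c a)

/-- The covariant derivative of a bilinear form. -/
def nablaForm (b c a : ι) : A := S.D b (P c a)
  - ∑ e, (S.christoffel e b c * P e a + S.christoffel e b a * P c e)

/-- The components of the Cotton tensor. -/
def cotton (a b c : ι) : A := S.nablaForm P b c a - S.nablaForm P c b a

lemma form_single (a b : ι) : S.leviCivita.form (Pi.single a 1) (Pi.single b 1) = S.G a b := by
  change S.form _ _ = _
  simp [form_single_right, Pi.single_apply]

lemma toBilin'_single (P : Matrix ι ι A) (a b : ι) :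
    Matrix.toBilin' P (Pi.single a 1) (Pi.single b 1) = P a b := by
  simp [Matrix.toBilin'_apply, Pi.single_apply]

/-- Tensoriality: both sides are linear over the functions, so comparison on coordinate fields
suffices. This and `cotton_eq_sum` tie the formal tensors to the index formulas. -/
lemma weyl_eq_sum (X Y Z W : ι → A) : S.leviCivita.weyl (Matrix.toBilin' P) X Y Z W =
    ∑ a, ∑ b, ∑ c, ∑ d, S.weyl P a b c d * (X a * Y b * Z c * W d) := by
  rw [quadrilinear_eq_sum (T := S.leviCivita.weyl (Matrix.toBilin' P))]
  · simp only [LeviCivitaAlgebra.weyl, riem_single, form_single, toBilin'_single, weyl]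
  all_goals
    refine fun _ _ _ => ⟨fun _ _ => ?_, fun _ _ => ?_⟩ <;>
    simp only [LeviCivitaAlgebra.weyl, LeviCivitaAlgebra.riem, LeviCivitaAlgebra.curv_add_left,
      LeviCivitaAlgebra.curv_add_mid, LeviCivitaAlgebra.curv_add_right,
      LeviCivitaAlgebra.curv_smul_left, LeviCivitaAlgebra.curv_smul_mid,
      LeviCivitaAlgebra.curv_smul_right, map_add, map_smul, LinearMap.add_apply,
      LinearMap.smul_apply, smul_eq_mul] <;>
    ring

lemma nablaForm_eq_sum (X Y Z : ι → A) : S.leviCivita.nablaForm (Matrix.toBilin' P) X Y Z =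
    ∑ a, ∑ b, ∑ c, S.nablaForm P a b c * (X a * Y b * Z c) := by
  rw [trilinear_eq_sum (T := S.leviCivita.nablaForm (Matrix.toBilin' P))]
  · refine Finset.sum_congr rfl fun a _ => Finset.sum_congr rfl fun b _ =>
      Finset.sum_congr rfl fun c _ => ?_
    congr 1
    simp only [LeviCivitaAlgebra.nablaForm, toBilin'_single]
    simp only [leviCivita, conn_single, Matrix.toBilin'_apply, nabla_single, der_apply, nablaForm,
      Pi.single_apply, Finset.sum_add_distrib]
    simp [sub_sub, mul_comm]
  all_goals
    refine fun _ _ => ⟨fun _ _ => ?_, fun _ _ => ?_⟩ <;>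
    simp only [LeviCivitaAlgebra.nablaForm, map_add, map_smul, LinearMap.add_apply,
      LinearMap.smul_apply, smul_eq_mul, AddMonoidHom.add_apply, LeviCivitaAlgebra.conn_smul_left,
      LeviCivitaAlgebra.conn_smul_right, LeviCivitaAlgebra.der_smul, LeviCivitaAlgebra.der_mul] <;>
    ring

lemma cotton_eq_sum (X Y Z : ι → A) : S.leviCivita.cotton (Matrix.toBilin' P) X Y Z =
    ∑ a, ∑ b, ∑ c, S.cotton P a b c * (X a * Y b * Z c) := by
  simp only [LeviCivitaAlgebra.cotton, nablaForm_eq_sum, cotton, sub_mul, Finset.sum_sub_distrib]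
  congr 1
  · rw [Finset.sum_congr rfl fun _ _ => Finset.sum_comm, Finset.sum_comm]
    refine Finset.sum_congr rfl fun a _ => ?_
    exact Finset.sum_congr rfl fun b _ => Finset.sum_congr rfl fun c _ => by ring
  · rw [Finset.sum_congr rfl fun _ _ => Finset.sum_comm, Finset.sum_comm]
    refine Finset.sum_congr rfl fun a _ => ?_
    rw [Finset.sum_comm]
    exact Finset.sum_congr rfl fun b _ => Finset.sum_congr rfl fun c _ => by ring

end CoordMetric

/-! ### The ring of smooth complex functions on an open set -/

/-- The extension by zero of a function on an open subset of `ℝ⁵`. -/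
def extendZero {U : TopologicalSpace.Opens R5} (f : U → ℂ) : R5 → ℂ :=
  Function.extend Subtype.val f 0

lemma extendZero_apply {U : TopologicalSpace.Opens R5} (f : U → ℂ) (x : U) :
    extendZero f x = f x :=
  Subtype.val_injective.extend_apply f 0 x

lemma contDiffOn_extendZero_iff {U : TopologicalSpace.Opens R5} {f : U → ℂ} {F : R5 → ℂ}
    (h : ∀ x : U, f x = F x) : ContDiffOn ℝ ∞ (extendZero f) U ↔ ContDiffOn ℝ ∞ F U :=
  contDiffOn_congr fun x hx => by rw [extendZero_apply f ⟨x, hx⟩, h]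

/-- The algebra of smooth complex functions on an open subset of `ℝ⁵`. -/
def SmoothFn (U : TopologicalSpace.Opens R5) : Subalgebra ℂ (U → ℂ) where
  carrier := {f | ContDiffOn ℝ ∞ (extendZero f) U}
  mul_mem' {f h} hf hh := (contDiffOn_extendZero_iff
    (F := fun x => extendZero f x * extendZero h x) (by simp [extendZero_apply])).2
      (ContDiffOn.mul hf hh)
  add_mem' {f h} hf hh := (contDiffOn_extendZero_iff
    (F := fun x => extendZero f x + extendZero h x) (by simp [extendZero_apply])).2
      (ContDiffOn.add hf hh)
  algebraMap_mem' c := (contDiffOn_extendZero_iff (F := fun _ => c) (by simp)).2 contDiffOn_const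

namespace SmoothFn

variable {U : TopologicalSpace.Opens R5}

/-- The restriction of a smooth function to `U`. -/
def ofFun (F : R5 → ℂ) (hF : ContDiffOn ℝ ∞ F U) : SmoothFn U :=
  ⟨fun x => F x, (contDiffOn_extendZero_iff fun _ => rfl).2 hF⟩

/-- Evaluation at a point. -/
def eval (x : U) : SmoothFn U →+* ℂ :=
  (Pi.evalRingHom (fun _ : U => ℂ) x).comp (SmoothFn U).val.toRingHom

lemma eval_ofFun (F : R5 → ℂ) (hF : ContDiffOn ℝ ∞ F U) (x : U) : eval x (ofFun F hF) = F x := rfl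

lemma ext_eval {f h : SmoothFn U} (H : ∀ x, eval x f = eval x h) : f = h :=
  Subtype.ext (funext H)

lemma extendZero_eq_eval (f : SmoothFn U) (x : U) : extendZero (f : U → ℂ) x = eval x f :=
  extendZero_apply _ x

lemma differentiableAt (f : SmoothFn U) (x : U) :
    DifferentiableAt ℝ (extendZero (f : U → ℂ)) x :=
  (f.2.contDiffAt (U.isOpen.mem_nhds x.2)).differentiableAt (by simp)

/-- The partial derivative in the direction `a`. -/
def partialDeriv (a : Fin 5) : SmoothFn U →+ SmoothFn U :=
  AddMonoidHom.mk' (fun f => ofFun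
    (fun p => fderiv ℝ (extendZero (f : U → ℂ)) p (EuclideanSpace.single a 1))
    ((ContDiffOn.fderiv_of_isOpen f.2 U.isOpen (m := ∞) (by simp)).clm_apply contDiffOn_const)) (by
  intro f h
  refine ext_eval fun x => ?_
  rw [map_add, eval_ofFun, eval_ofFun, eval_ofFun, ← add_apply,
    ← fderiv_add (differentiableAt f x) (differentiableAt h x)]
  congr 1
  refine Filter.EventuallyEq.fderiv_eq ?_
  filter_upwards [U.isOpen.mem_nhds x.2] with y hy
  rw [extendZero_eq_eval _ ⟨y, hy⟩, map_add, Pi.add_apply, extendZero_eq_eval f ⟨y, hy⟩,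
    extendZero_eq_eval h ⟨y, hy⟩])

lemma eval_partialDeriv {a : Fin 5} {f : SmoothFn U} {F : R5 → ℂ} (h : ∀ x, eval x f = F x)
    (x : U) : eval x (partialDeriv a f) = fderiv ℝ F x (EuclideanSpace.single a 1) := by
  change fderiv ℝ (extendZero (f : U → ℂ)) x (EuclideanSpace.single a 1) = _
  congr 1
  refine Filter.EventuallyEq.fderiv_eq ?_
  filter_upwards [U.isOpen.mem_nhds x.2] with y hy
  rw [extendZero_eq_eval f ⟨y, hy⟩, h]

lemma partialDeriv_mul (a : Fin 5) (f h : SmoothFn U) :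
    partialDeriv a (f * h) = f * partialDeriv a h + partialDeriv a f * h := by
  refine ext_eval fun x => ?_
  rw [eval_partialDeriv (F := fun y => extendZero (f : U → ℂ) y * extendZero (h : U → ℂ) y)
    (fun y => by rw [map_mul, extendZero_eq_eval, extendZero_eq_eval]),
    fderiv_fun_mul (differentiableAt f x) (differentiableAt h x)]
  simp only [map_add, map_mul, ← extendZero_eq_eval f x, ← extendZero_eq_eval h x]
  rw [eval_partialDeriv (f := f) fun y => (extendZero_eq_eval f y).symm,
    eval_partialDeriv (f := h) fun y => (extendZero_eq_eval h y).symm]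
  simp [mul_comm]

lemma partialDeriv_comm (a b : Fin 5) (f : SmoothFn U) :
    partialDeriv a (partialDeriv b f) = partialDeriv b (partialDeriv a f) := by
  refine ext_eval fun x => ?_
  have hf : ContDiffAt ℝ ∞ (extendZero (f : U → ℂ)) x := f.2.contDiffAt (U.isOpen.mem_nhds x.2)
  have hd : DifferentiableAt ℝ (fderiv ℝ (extendZero (f : U → ℂ))) x :=
    (hf.fderiv_right (m := ∞) (by simp)).differentiableAt (by simp)
  have key : ∀ a b : Fin 5, eval x (partialDeriv a (partialDeriv b f)) =
      fderiv ℝ (fderiv ℝ (extendZero (f : U → ℂ))) x (EuclideanSpace.single a 1)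
        (EuclideanSpace.single b 1) := fun a b => by
    rw [eval_partialDeriv (F := fun p => fderiv ℝ (extendZero (f : U → ℂ)) p
      (EuclideanSpace.single b 1)) (fun y => eval_partialDeriv
        (fun z => (extendZero_eq_eval f z).symm) y), fderiv_clm_apply hd (by fun_prop)]
    simp
  rw [key, key]
  exact (hf.isSymmSndFDerivAt (by
    rw [minSmoothness_of_isRCLikeNormedField]; exact WithTop.coe_le_coe.2 le_top)).eq _ _

/-- `f` is the complexification of the real function `F`. -/
def IsComplexification (f : SmoothFn U) (F : R5 → ℝ) : Prop := ∀ x : U, eval x f = (F x : ℂ)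

lemma IsComplexification.partialDeriv {f : SmoothFn U} {F : R5 → ℝ} (h : IsComplexification f F)
    (a : Fin 5) : IsComplexification (partialDeriv a f) (Coord.pd a F) := by
  intro x
  -- Nothing is assumed about `F` outside `U`; near `x` it agrees with the real part of `f`.
  have hF : DifferentiableAt ℝ F x := by
    refine (Complex.reCLM.differentiableAt.comp (x : R5) (differentiableAt f x)).congr_of_eventuallyEq
      ?_
    filter_upwards [U.isOpen.mem_nhds x.2] with y hy
    simp [extendZero_eq_eval f ⟨y, hy⟩, h ⟨y, hy⟩]
  rw [eval_partialDeriv (F := fun y => (F y : ℂ)) h]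
  have := (Complex.ofRealCLM.hasFDerivAt.comp (x : R5) hF.hasFDerivAt).fderiv
  change fderiv ℝ (Complex.ofRealCLM ∘ F) x _ = _
  rw [this]
  simp [Coord.pd]

end SmoothFn

/-! ### Smooth metrics on an open set and their complexified curvature -/

lemma contDiffOn_det {n : Type*} [Fintype n] [DecidableEq n] {𝕜 : Type*} [RCLike 𝕜]
    {U : Set R5} {G : R5 → Matrix n n 𝕜}
    (hG : ∀ i j, ContDiffOn ℝ ∞ (fun p => G p i j) U) : ContDiffOn ℝ ∞ (fun p => (G p).det) U := by
  simp only [Matrix.det_apply']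
  exact ContDiffOn.sum fun σ _ => contDiffOn_const.mul (contDiffOn_prod fun i _ => hG _ _)

/-- Cramer's rule: the entries are quotients of determinants. -/
lemma contDiffOn_matrix_inv {n : Type*} [Fintype n] [DecidableEq n] {𝕜 : Type*} [RCLike 𝕜]
    {U : Set R5} {G : R5 → Matrix n n 𝕜}
    (hG : ∀ i j, ContDiffOn ℝ ∞ (fun p => G p i j) U) (hdet : ∀ p ∈ U, (G p).det ≠ 0) (i j : n) :
    ContDiffOn ℝ ∞ (fun p => (G p)⁻¹ i j) U := by
  simp only [Matrix.inv_def, Ring.inverse_eq_inv', Matrix.smul_apply, smul_eq_mul,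
    Matrix.adjugate_apply]
  refine ((contDiffOn_det hG).inv hdet).mul (contDiffOn_det fun k l => ?_)
  simp only [Matrix.updateRow_apply]
  split_ifs
  · exact contDiffOn_const
  · exact hG _ _

open SmoothFn

/-- A smooth symmetric nondegenerate matrix of functions on `U`. -/
structure IsMetricOn (G : R5 → Matrix (Fin 5) (Fin 5) ℝ) (U : TopologicalSpace.Opens R5) :
    Prop where
  contDiffOn : ∀ i j, ContDiffOn ℝ ∞ (fun p => G p i j) U
  symm : ∀ p ∈ U, ∀ i j, G p i j = G p j i
  det_ne_zero : ∀ p ∈ U, (G p).det ≠ 0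

namespace IsMetricOn

variable {G : R5 → Matrix (Fin 5) (Fin 5) ℝ} {U : TopologicalSpace.Opens R5} (h : IsMetricOn G U)

/-- The metric with components `G` over the ring of smooth complex functions. -/
def coordMetric : CoordMetric (Fin 5) (SmoothFn U) where
  D := partialDeriv
  G := Matrix.of fun i j => ofFun (fun p => (G p i j : ℂ))
    (Complex.ofRealCLM.contDiff.comp_contDiffOn (h.contDiffOn i j))
  H := Matrix.of fun i j => ofFun (fun p => ((G p)⁻¹ i j : ℂ))
    (Complex.ofRealCLM.contDiff.comp_contDiffOn (contDiffOn_matrix_inv h.contDiffOn h.det_ne_zero i j))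
  half := ofFun (fun _ => 1 / 2) contDiffOn_const
  D_mul := partialDeriv_mul
  D_comm := partialDeriv_comm
  G_symm a b := ext_eval fun x => by
    change (G x a b : ℂ) = G x b a
    rw [h.symm x x.2 a b]
  H_mul_G := by
    refine Matrix.ext fun i j => ext_eval fun x => ?_
    have := congrFun (congrFun (Matrix.nonsing_inv_mul (G x) (h.det_ne_zero x x.2).isUnit) i) j
    rw [Matrix.mul_apply, Matrix.one_apply] at this
    rw [Matrix.mul_apply, Matrix.one_apply, map_sum, apply_ite (eval x), map_one, map_zero]
    simp only [map_mul]
    change ∑ k, ((G x)⁻¹ i k : ℂ) * (G x k j : ℂ) = _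
    have h2 := congrArg (fun r : ℝ => (r : ℂ)) this
    push_cast at h2
    rw [h2]; split_ifs <;> simp
  two_mul_half := ext_eval fun x => by
    rw [map_mul, eval_ofFun, map_ofNat, map_one]; norm_num

lemma G_isComplexification (i j : Fin 5) :
    IsComplexification (h.coordMetric.G i j) (fun p => G p i j) := fun _ => rfl

lemma H_isComplexification (i j : Fin 5) :
    IsComplexification (h.coordMetric.H i j) (fun p => (G p)⁻¹ i j) := fun _ => rfl

lemma christoffel_isComplexification (c a b : Fin 5) :
    IsComplexification (h.coordMetric.christoffel c a b) (Coord.christoffel G c a b) := by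
  intro x
  have hD : ∀ a i j, eval x (h.coordMetric.D a (h.coordMetric.G i j)) =
    (Coord.pd a (fun q => G q i j) x : ℂ) := fun a i j =>
      (h.G_isComplexification i j).partialDeriv a x
  simp only [CoordMetric.christoffel, Coord.christoffel, map_mul, map_sum, map_add, map_sub, hD,
    h.H_isComplexification _ _ x]
  push_cast
  rfl

lemma riemannUp_isComplexification (a b d c : Fin 5) :
    IsComplexification (h.coordMetric.riemannUp a b d c) (Coord.riemannUp G a b d c) := by
  intro x
  have hD : ∀ a c b d, eval x (h.coordMetric.D a (h.coordMetric.christoffel c b d)) =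
    (Coord.pd a (Coord.christoffel G c b d) x : ℂ) := fun a c b d =>
      (h.christoffel_isComplexification c b d).partialDeriv a x
  simp only [CoordMetric.riemannUp, Coord.riemannUp, map_mul, map_sum, map_add, map_sub, hD,
    h.christoffel_isComplexification _ _ _ x]
  push_cast
  rfl

/-- The Schouten tensor. -/
def rho : Matrix (Fin 5) (Fin 5) (SmoothFn U) := Matrix.of fun a b =>
  algebraMap ℂ _ (1 / 3) * (h.coordMetric.ricci a b - algebraMap ℂ _ (1 / 8) *
    (∑ c, ∑ d, h.coordMetric.H c d * h.coordMetric.ricci c d) * h.coordMetric.G a b)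

lemma rho_symm (a b : Fin 5) : h.rho a b = h.rho b a := by
  simp only [rho, Matrix.of_apply, h.coordMetric.ricci_symm a b, h.coordMetric.G_symm a b]

lemma ricci_isComplexification (b d : Fin 5) :
    IsComplexification (h.coordMetric.ricci b d) (Coord.ricci G b d) := by
  intro x
  simp only [CoordMetric.ricci, Coord.ricci, map_sum, h.riemannUp_isComplexification _ _ _ _ x]
  push_cast
  rfl

lemma eval_algebraMap (x : U) (c : ℂ) : eval x (algebraMap ℂ _ c) = c := rfl

lemma rho_isComplexification (a b : Fin 5) :
    IsComplexification (h.rho a b) (Coord.rho G a b) := by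
  intro x
  simp only [rho, Coord.rho, Coord.scalar, Matrix.of_apply, map_sum, map_mul, map_sub,
    eval_algebraMap, h.ricci_isComplexification _ _ x, h.G_isComplexification _ _ x,
    h.H_isComplexification _ _ x]
  push_cast
  ring

lemma weyl_isComplexification (a b c d : Fin 5) :
    IsComplexification (h.coordMetric.weyl h.rho a b c d) (Coord.weyl G a b c d) := by
  intro x
  simp only [CoordMetric.weyl, Coord.weyl, CoordMetric.riemann, Coord.riemann, map_sum, map_mul,
    map_add, map_sub, h.riemannUp_isComplexification _ _ _ _ x, h.rho_isComplexification _ _ x,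
    h.G_isComplexification _ _ x]
  push_cast
  rfl

lemma cotton_isComplexification (a b c : Fin 5) :
    IsComplexification (h.coordMetric.cotton h.rho a b c) (Coord.cottonYork G a b c) := by
  intro x
  have hD : ∀ a i j, eval x (h.coordMetric.D a (h.rho i j)) =
    (Coord.pd a (Coord.rho G i j) x : ℂ) := fun a i j =>
      (h.rho_isComplexification i j).partialDeriv a x
  simp only [CoordMetric.cotton, Coord.cottonYork, CoordMetric.nablaForm, Coord.nablaRho, map_sum,
    map_mul, map_add, map_sub, h.christoffel_isComplexification _ _ _ x, hD,
    h.rho_isComplexification _ _ x]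
  push_cast
  rfl

end IsMetricOn

/-! ### Vector fields and metric components in a chart -/

section Chart

variable {M : Type*} [TopologicalSpace M] [ChartedSpace R5 M] [IsManifold (𝓡 5) ∞ M]
  {e : OpenPartialHomeomorph M R5} (he : e ∈ IsManifold.maximalAtlas (𝓡 5) ∞ M)
include he

lemma mdifferentiable_of_mem_maximalAtlas : e.MDifferentiable (𝓡 5) (𝓡 5) :=
  ⟨(contMDiffOn_of_mem_maximalAtlas he).mdifferentiableOn (by simp),
    (contMDiffOn_symm_of_mem_maximalAtlas he).mdifferentiableOn (by simp)⟩

lemma isInvertible_mfderiv_chart {x : M} (hx : x ∈ e.source) :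
    (mfderiv (𝓡 5) (𝓡 5) e x).IsInvertible :=
  ⟨(mdifferentiable_of_mem_maximalAtlas he).mfderiv hx, rfl⟩

lemma isInvertible_mfderiv_chart_symm {p : R5} (hp : p ∈ e.target) :
    (mfderiv (𝓡 5) (𝓡 5) e.symm p).IsInvertible :=
  ⟨(mdifferentiable_of_mem_maximalAtlas he).symm.mfderiv hp, rfl⟩

lemma mfderiv_chart_symm_apply {p : R5} (hp : p ∈ e.target) (w : R5) :
    mfderiv (𝓡 5) (𝓡 5) e (e.symm p) (mfderiv (𝓡 5) (𝓡 5) e.symm p w) = w := by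
  have := (mdifferentiable_of_mem_maximalAtlas he).comp_symm_deriv hp
  exact congrArg (fun T => T w) this

lemma mfderiv_chart_mpullback (V : R5 → R5) {x : M} (hx : x ∈ e.source) :
    mfderiv (𝓡 5) (𝓡 5) e x (VectorField.mpullback (𝓡 5) (𝓡 5) e V x) = V (e x) :=
  (isInvertible_mfderiv_chart he hx).self_apply_inverse _

lemma mpullback_chart (V : R5 → R5) {p : R5} (hp : p ∈ e.target) :
    VectorField.mpullback (𝓡 5) (𝓡 5) e V (e.symm p) = mfderiv (𝓡 5) (𝓡 5) e.symm p (V p) := by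
  apply (mdifferentiable_of_mem_maximalAtlas he).mfderiv_injective (e.map_target hp)
  rw [mfderiv_chart_mpullback he V (e.map_target hp), e.right_inv hp]
  exact (mfderiv_chart_symm_apply he hp _).symm

lemma contMDiffOn_mpullback_chart {V : R5 → R5} {U : Set R5} (hU : IsOpen U)
    (hV : ContDiffOn ℝ ∞ V U) :
    ContMDiffOn (𝓡 5) (𝓡 5).tangent ∞
      (fun x => (⟨x, VectorField.mpullback (𝓡 5) (𝓡 5) e V x⟩ : TangentBundle (𝓡 5) M))
      (e.source ∩ e ⁻¹' U) := by
  intro x hx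
  have h1 : ContMDiffAt (𝓡 5) (𝓡 5).tangent ∞
      (fun p => (⟨p, V p⟩ : TangentBundle (𝓡 5) R5)) (e x) := by
    exact contMDiffAt_vectorSpace_iff_contDiffAt.2 (hV.contDiffAt (hU.mem_nhds hx.2))
  exact (h1.mpullback_vectorField_preimage (contMDiffAt_of_mem_maximalAtlas he hx.1)
    (isInvertible_mfderiv_chart he hx.1) (by simp)).contMDiffWithinAt

lemma contDiffOn_mpullback_chart_symm {W : ∀ x : M, TangentSpace (𝓡 5) x} {U : Set M}
    (hU : IsOpen U)
    (hW : ContMDiffOn (𝓡 5) (𝓡 5).tangent ∞ (fun x => (⟨x, W x⟩ : TangentBundle (𝓡 5) M)) U) :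
    ContDiffOn ℝ ∞ (fun p => (VectorField.mpullback (𝓡 5) (𝓡 5) e.symm W p : R5))
      (e.target ∩ e.symm ⁻¹' U) := by
  intro p hp
  have h1 := (hW.contMDiffAt (hU.mem_nhds hp.2)).mpullback_vectorField_preimage
    (contMDiffAt_symm_of_mem_maximalAtlas he hp.1)
    (isInvertible_mfderiv_chart_symm he hp.1) (m := ∞) (by simp)
  exact (contMDiffAt_vectorSpace_iff_contDiffAt.1 h1).contDiffWithinAt

lemma mfderiv_chart_eq_mpullback_symm (W : ∀ x : M, TangentSpace (𝓡 5) x) {p : R5}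
    (hp : p ∈ e.target) : mfderiv (𝓡 5) (𝓡 5) e (e.symm p) (W (e.symm p)) =
      VectorField.mpullback (𝓡 5) (𝓡 5) e.symm W p := by
  apply (mdifferentiable_of_mem_maximalAtlas he).symm.mfderiv_injective hp
  rw [VectorField.mpullback_apply,
    (isInvertible_mfderiv_chart_symm he hp).self_apply_inverse]
  have := (mdifferentiable_of_mem_maximalAtlas he).symm_comp_deriv (e.map_target hp)
  rw [e.right_inv hp] at this
  exact congrArg (fun T => T (W (e.symm p))) this

/-- The coordinate fields are pullbacks of constant fields, hence smooth; a smooth section of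
bilinear forms is then evaluated on them. -/
lemma contDiffOn_coordMatrix (g : LorentzianMetric M) (i j : Fin 5) :
    ContDiffOn ℝ ∞ (fun p => g.coordMatrix e p i j) e.target := by
  have hv : ∀ i : Fin 5, ContMDiffOn (𝓡 5) (𝓡 5).tangent ∞ (fun p => (⟨e.symm p,
      mfderiv (𝓡 5) (𝓡 5) e.symm p (EuclideanSpace.single i (1 : ℝ) : R5)⟩ :
        TangentBundle (𝓡 5) M)) e.target := by
    intro i
    have h1 := contMDiffOn_mpullback_chart he isOpen_univ
      (V := fun _ => EuclideanSpace.single i (1 : ℝ)) contDiffOn_const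
    refine (h1.comp (contMDiffOn_symm_of_mem_maximalAtlas he)
      (fun p hp => ⟨e.map_target hp, Set.mem_univ _⟩)).congr fun p hp => ?_
    simp only [Function.comp]
    rw [mpullback_chart he _ hp]
  have hg := g.contMDiff.comp_contMDiffOn (contMDiffOn_symm_of_mem_maximalAtlas he)
  intro p hp
  have : ContMDiffWithinAt (𝓡 5) ((𝓡 5).prod 𝓘(ℝ)) ∞
      (fun p ↦ Bundle.TotalSpace.mk' ℝ (E := Bundle.Trivial M ℝ) (e.symm p)
        (g.form (e.symm p)
          (mfderiv (𝓡 5) (𝓡 5) e.symm p (EuclideanSpace.single i (1 : ℝ) : R5))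
          (mfderiv (𝓡 5) (𝓡 5) e.symm p (EuclideanSpace.single j (1 : ℝ) : R5)))) e.target p :=
    ContMDiffWithinAt.clm_bundle_apply₂ (F₁ := R5) (F₂ := R5) (hg p hp) (hv i p hp) (hv j p hp)
  rw [Bundle.contMDiffWithinAt_totalSpace] at this
  exact contMDiffWithinAt_iff_contDiffWithinAt.1 this.2

end Chart

/-! ### Complexified tangent vectors in coordinates -/

section ComplexCoordinates

variable {M : Type*} [TopologicalSpace M] [ChartedSpace R5 M]

/-- The coordinate differential `dx^i` of the chart `e`. -/
def dcoord (e : OpenPartialHomeomorph M R5) (x : M) (i : Fin 5) : TangentSpace (𝓡 5) x →ₗ[ℝ] ℝ :=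
  (EuclideanSpace.proj i : R5 →L[ℝ] ℝ).toLinearMap ∘ₗ
    (mfderiv (𝓡 5) (𝓡 5) e x : TangentSpace (𝓡 5) x →L[ℝ] R5).toLinearMap

lemma dcoord_eq {e : OpenPartialHomeomorph M R5} {x : M} {w : TangentSpace (𝓡 5) x} {v : R5}
    (h : mfderiv (𝓡 5) (𝓡 5) e x w = v) (i : Fin 5) : dcoord e x i w = v i := by
  rw [← h]; rfl

lemma dcoordC_tmul (e : OpenPartialHomeomorph M R5) (x : M) (i : Fin 5) (c : ℂ)
    (w : TangentSpace (𝓡 5) x) : dcoordC e x i (c ⊗ₜ[ℝ] w) = c * (dcoord e x i w : ℂ) := by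
  change TensorProduct.AlgebraTensorModule.rid ℝ ℂ ℂ (c ⊗ₜ[ℝ] (dcoord e x i w)) = _
  simp [mul_comm]

lemma dcoordC_val (e : OpenPartialHomeomorph M R5) (X : CVectorField M) (x : M) (i : Fin 5) :
    dcoordC e x i (X.val x) = (dcoord e x i (X.re x) : ℂ)
      + Complex.I * (dcoord e x i (X.im x) : ℂ) := by
  rw [CVectorField.val, map_add, dcoordC_tmul, dcoordC_tmul, one_mul]

/-- The complex tangent vector with given components in a chart. -/
def ofCoordsC (e : OpenPartialHomeomorph M R5) (p : R5) (v : Fin 5 → ℂ) : CTangent (e.symm p) :=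
  ∑ i, v i ⊗ₜ[ℝ] (mfderiv (𝓡 5) (𝓡 5) e.symm p (EuclideanSpace.single i (1 : ℝ) : R5) :
    TangentSpace (𝓡 5) (e.symm p))

variable [IsManifold (𝓡 5) ∞ M]
  {e : OpenPartialHomeomorph M R5} (he : e ∈ IsManifold.maximalAtlas (𝓡 5) ∞ M)
include he

lemma dcoord_single {p : R5} (hp : p ∈ e.target) (i j : Fin 5) :
    dcoord e (e.symm p) i (mfderiv (𝓡 5) (𝓡 5) e.symm p (EuclideanSpace.single j (1 : ℝ) : R5)) =
      if i = j then 1 else 0 := by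
  rw [dcoord_eq (mfderiv_chart_symm_apply he hp _)]
  simp

lemma ext_dcoord {x : M} (hx : x ∈ e.source) {v w : TangentSpace (𝓡 5) x}
    (h : ∀ i, dcoord e x i v = dcoord e x i w) : v = w := by
  apply (mdifferentiable_of_mem_maximalAtlas he).mfderiv_injective hx
  exact PiLp.ext h

lemma sum_dcoord_smul {p : R5} (hp : p ∈ e.target) (w : TangentSpace (𝓡 5) (e.symm p)) :
    ∑ i, dcoord e (e.symm p) i w •
      (mfderiv (𝓡 5) (𝓡 5) e.symm p (EuclideanSpace.single i (1 : ℝ) : R5) :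
        TangentSpace (𝓡 5) (e.symm p)) = w := by
  refine ext_dcoord he (e.map_target hp) fun i => ?_
  rw [map_sum, Finset.sum_congr rfl fun k _ => (LinearMap.map_smul (dcoord e (e.symm p) i) _ _)]
  simp [dcoord_single he hp]

lemma dcoordC_ofCoordsC {p : R5} (hp : p ∈ e.target) (v : Fin 5 → ℂ) (i : Fin 5) :
    dcoordC e (e.symm p) i (ofCoordsC e p v) = v i := by
  simp only [ofCoordsC]
  rw [map_sum, Finset.sum_congr rfl fun k _ => dcoordC_tmul e (e.symm p) i (v k) _]
  simp only [dcoord_single he hp, apply_ite Complex.ofReal, Complex.ofReal_one, Complex.ofReal_zero]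
  simp

lemma ofCoordsC_dcoordC {p : R5} (hp : p ∈ e.target) (V : CTangent (e.symm p)) :
    ofCoordsC e p (fun i => dcoordC e (e.symm p) i V) = V := by
  induction V using TensorProduct.induction_on with
  | zero => simp [ofCoordsC]
  | add u v hu hv =>
    conv_rhs => rw [← hu, ← hv]
    simp [ofCoordsC, TensorProduct.add_tmul, Finset.sum_add_distrib]
  | tmul c w =>
    conv_rhs => rw [← sum_dcoord_smul he hp w]
    simp only [ofCoordsC, dcoordC_tmul, TensorProduct.tmul_sum]
    refine Finset.sum_congr rfl fun i _ => ?_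
    rw [← TensorProduct.smul_tmul, Complex.real_smul, mul_comm]

lemma ext_dcoordC {p : R5} (hp : p ∈ e.target) {V W : CTangent (e.symm p)}
    (h : ∀ i, dcoordC e (e.symm p) i V = dcoordC e (e.symm p) i W) : V = W := by
  rw [← ofCoordsC_dcoordC he hp V, ← ofCoordsC_dcoordC he hp W, funext h]

lemma formC_eq_sum (g : LorentzianMetric M) {p : R5} (hp : p ∈ e.target)
    (V W : CTangent (e.symm p)) : g.formC (e.symm p) V W =
      ∑ i, ∑ j, (g.coordMatrix e p i j : ℂ) *
        (dcoordC e (e.symm p) i V * dcoordC e (e.symm p) j W) := by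
  conv_lhs => rw [← ofCoordsC_dcoordC he hp V, ← ofCoordsC_dcoordC he hp W]
  simp only [ofCoordsC, map_sum, LinearMap.sum_apply]
  rw [Finset.sum_comm]
  refine Finset.sum_congr rfl fun i _ => Finset.sum_congr rfl fun j _ => ?_
  rw [LorentzianMetric.formC, LinearMap.BilinForm.baseChange_tmul]
  simp [LorentzianMetric.coordMatrix]

end ComplexCoordinates

/-! ### The complexified metric -/

section Form

variable {M : Type*} [TopologicalSpace M] [ChartedSpace R5 M] [IsManifold (𝓡 5) ∞ M]
  (g : LorentzianMetric M) (x : M)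

lemma formC_tmul (a b : ℂ) (v w : TangentSpace (𝓡 5) x) :
    g.formC x (a ⊗ₜ v) (b ⊗ₜ w) = (b * a) * (g.form x v w : ℂ) := by
  rw [LorentzianMetric.formC, LinearMap.BilinForm.baseChange_tmul]
  simp [mul_comm]

lemma formC_symm (V W : CTangent x) : g.formC x V W = g.formC x W V := by
  induction V using TensorProduct.induction_on with
  | zero => simp
  | add u v hu hv => simp [hu, hv]
  | tmul a v =>
    induction W using TensorProduct.induction_on with
    | zero => simp
    | add u v hu hv => simp [hu, hv]
    | tmul b w => rw [formC_tmul, formC_tmul, g.symm]; ring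

/-- A Lorentz-orthonormal basis remains a basis after complexification, and pairing with a basis
vector reads off a coordinate up to sign. -/
lemma formC_nondegenerate : (g.formC x).Nondegenerate := by
  obtain ⟨b, hb⟩ := g.lorentzian x
  let c := Algebra.TensorProduct.basis ℂ b
  have key : ∀ V : CTangent x, (∀ W, g.formC x V W = 0) → V = 0 := by
    intro V hV
    rw [← c.sum_repr V]
    refine Finset.sum_eq_zero fun j _ => ?_
    have h1 := hV (c j)
    rw [← c.sum_repr V] at h1
    simp only [map_sum, map_smul, LinearMap.sum_apply, LinearMap.smul_apply, c,
      Algebra.TensorProduct.basis_apply, formC_tmul, hb] at h1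
    rw [Finset.sum_eq_single j (fun i _ hi => by simp [hi]) (by simp)] at h1
    have h3 : c.repr V j = 0 := by
      by_cases hj : j = 0 <;> simpa [hj] using h1
    rw [h3, zero_smul]
  exact ⟨key, fun V hV => key V fun W => by rw [formC_symm]; exact hV W⟩

lemma finrank_cTangent : Module.finrank ℂ (CTangent x) = 5 := by
  rw [Module.finrank_baseChange]
  exact finrank_euclideanSpace_fin

instance : FiniteDimensional ℂ (CTangent x) :=
  FiniteDimensional.of_finrank_pos (by rw [finrank_cTangent x]; norm_num)

end Form

/-! ### Complex vector fields and their Lie brackets in a chart -/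

section Fields

variable {U : TopologicalSpace.Opens R5}

/-- The real part of a complex vector field in coordinates. -/
def reVec (X : Fin 5 → SmoothFn U) (p : R5) : R5 :=
  WithLp.toLp 2 fun i => (extendZero (X i : U → ℂ) p).re

/-- The imaginary part of a complex vector field in coordinates. -/
def imVec (X : Fin 5 → SmoothFn U) (p : R5) : R5 :=
  WithLp.toLp 2 fun i => (extendZero (X i : U → ℂ) p).im

lemma contDiffOn_reVec (X : Fin 5 → SmoothFn U) : ContDiffOn ℝ ∞ (reVec X) U :=
  (contDiffOn_piLp 2).2 fun i => Complex.reCLM.contDiff.comp_contDiffOn (X i).2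

lemma contDiffOn_imVec (X : Fin 5 → SmoothFn U) : ContDiffOn ℝ ∞ (imVec X) U :=
  (contDiffOn_piLp 2).2 fun i => Complex.imCLM.contDiff.comp_contDiffOn (X i).2

lemma fderiv_reVec (X : Fin 5 → SmoothFn U) (p : U) (v : R5) (i : Fin 5) :
    fderiv ℝ (reVec X) p v i = (fderiv ℝ (extendZero (X i : U → ℂ)) p v).re := by
  have h1 : DifferentiableAt ℝ (reVec X) p :=
    ((contDiffOn_reVec X).contDiffAt (U.isOpen.mem_nhds p.2)).differentiableAt (by simp)
  have h2 := ((EuclideanSpace.proj i : R5 →L[ℝ] ℝ).hasFDerivAt.comp (p : R5) h1.hasFDerivAt).fderiv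
  have h3 := (Complex.reCLM.hasFDerivAt.comp (p : R5)
    (SmoothFn.differentiableAt (X i) p).hasFDerivAt).fderiv
  exact congrArg (fun T => T v) (h2.symm.trans h3)

lemma fderiv_imVec (X : Fin 5 → SmoothFn U) (p : U) (v : R5) (i : Fin 5) :
    fderiv ℝ (imVec X) p v i = (fderiv ℝ (extendZero (X i : U → ℂ)) p v).im := by
  have h1 : DifferentiableAt ℝ (imVec X) p :=
    ((contDiffOn_imVec X).contDiffAt (U.isOpen.mem_nhds p.2)).differentiableAt (by simp)
  have h2 := ((EuclideanSpace.proj i : R5 →L[ℝ] ℝ).hasFDerivAt.comp (p : R5) h1.hasFDerivAt).fderiv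
  have h3 := (Complex.imCLM.hasFDerivAt.comp (p : R5)
    (SmoothFn.differentiableAt (X i) p).hasFDerivAt).fderiv
  exact congrArg (fun T => T v) (h2.symm.trans h3)

lemma eval_der {G : R5 → Matrix (Fin 5) (Fin 5) ℝ} (h : IsMetricOn G U) (X : Fin 5 → SmoothFn U)
    (f : SmoothFn U) (p : U) : SmoothFn.eval p (h.coordMetric.der X f) =
      fderiv ℝ (extendZero (f : U → ℂ)) p (reVec X p)
        + Complex.I * fderiv ℝ (extendZero (f : U → ℂ)) p (imVec X p) := by
  have key : ∀ v : R5, fderiv ℝ (extendZero (f : U → ℂ)) p v =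
      ∑ a, (v a : ℂ) * fderiv ℝ (extendZero (f : U → ℂ)) p (EuclideanSpace.single a 1) := by
    intro v
    conv_lhs => rw [show v = ∑ a, v a • EuclideanSpace.single a (1 : ℝ) by
      ext j; simp [Pi.single_apply]]
    rw [map_sum]
    exact Finset.sum_congr rfl fun a _ => by rw [map_smul, Complex.real_smul]
  rw [key (reVec X p), key (imVec X p), CoordMetric.der_apply, map_sum, Finset.mul_sum,
    ← Finset.sum_add_distrib]
  refine Finset.sum_congr rfl fun a _ => ?_
  rw [map_mul]
  change _ * SmoothFn.eval p (SmoothFn.partialDeriv a f) = _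
  rw [SmoothFn.eval_partialDeriv fun y => (SmoothFn.extendZero_eq_eval f y).symm,
    ← SmoothFn.extendZero_eq_eval (X a) p]
  conv_lhs => rw [← Complex.re_add_im (extendZero (X a : U → ℂ) p)]
  simp only [reVec, imVec]
  ring

variable {M : Type*} [TopologicalSpace M] [ChartedSpace R5 M] [IsManifold (𝓡 5) ∞ M]
  {e : OpenPartialHomeomorph M R5}

/-- The complex vector field on the domain of a chart with given components. -/
def vectorField (e : OpenPartialHomeomorph M R5) (X : Fin 5 → SmoothFn U) : CVectorField M where
  re := VectorField.mpullback (𝓡 5) (𝓡 5) e (reVec X)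
  im := VectorField.mpullback (𝓡 5) (𝓡 5) e (imVec X)

variable (he : e ∈ IsManifold.maximalAtlas (𝓡 5) ∞ M)
include he

lemma smoothOn_vectorField (X : Fin 5 → SmoothFn U) :
    (vectorField e X).SmoothOn (e.source ∩ e ⁻¹' U) :=
  ⟨contMDiffOn_mpullback_chart he U.isOpen (contDiffOn_reVec X),
    contMDiffOn_mpullback_chart he U.isOpen (contDiffOn_imVec X)⟩

lemma dcoordC_vectorField (X : Fin 5 → SmoothFn U) (hU : (U : Set R5) ⊆ e.target) (p : U)
    (i : Fin 5) : dcoordC e (e.symm p) i ((vectorField e X).val (e.symm p)) =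
      SmoothFn.eval p (X i) := by
  have hx := e.map_target (hU p.2)
  rw [dcoordC_val]
  simp only [vectorField]
  rw [dcoord_eq (mfderiv_chart_mpullback he (reVec X) hx),
    dcoord_eq (mfderiv_chart_mpullback he (imVec X) hx), e.right_inv (hU p.2),
    ← SmoothFn.extendZero_eq_eval (X i) p]
  conv_rhs => rw [← Complex.re_add_im (extendZero (X i : U → ℂ) p)]
  simp only [reVec, imVec]
  ring

/-- Naturality of the Lie bracket under pullback by the chart reduces it to the bracket on the
coordinate space. -/
lemma dcoord_mlieBracket {V W : R5 → R5} (hV : ContDiffOn ℝ ∞ V U) (hW : ContDiffOn ℝ ∞ W U)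
    {p : R5} (hp : p ∈ U) (hp' : p ∈ e.target) (i : Fin 5) :
    dcoord e (e.symm p) i (VectorField.mlieBracket (𝓡 5)
      (VectorField.mpullback (𝓡 5) (𝓡 5) e V) (VectorField.mpullback (𝓡 5) (𝓡 5) e W) (e.symm p)) =
      fderiv ℝ W p (V p) i - fderiv ℝ V p (W p) i := by
  have hx := e.map_target hp'
  have h2 : (2 : ℕ∞ω) ≤ ∞ := WithTop.coe_le_coe.2 le_top
  have : IsManifold (𝓡 5) (minSmoothness ℝ 2) M := by
    rw [minSmoothness_of_isRCLikeNormedField]; exact IsManifold.of_le h2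
  have hd : ∀ {V : R5 → R5}, ContDiffOn ℝ ∞ V U → MDifferentiableAt (𝓡 5) (𝓡 5).tangent
      (fun p => (⟨p, V p⟩ : TangentBundle (𝓡 5) R5)) (e (e.symm p)) := by
    intro V hV
    rw [e.right_inv hp']
    have : ContMDiffAt (𝓡 5) (𝓡 5).tangent ∞ (fun p => (⟨p, V p⟩ : TangentBundle (𝓡 5) R5)) p :=
      contMDiffAt_vectorSpace_iff_contDiffAt.2 (hV.contDiffAt (U.isOpen.mem_nhds hp))
    exact this.mdifferentiableAt (by simp)
  have h1 := VectorField.mpullback_mlieBracket (hd hV) (hd hW)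
    (contMDiffAt_of_mem_maximalAtlas he hx)
    (by rw [minSmoothness_of_isRCLikeNormedField]; exact h2)
  have h3 : VectorField.mlieBracket (𝓡 5) (M := R5) V W = VectorField.lieBracket ℝ V W :=
    VectorField.mlieBracketWithin_univ.symm.trans
      (VectorField.mlieBracketWithin_eq_lieBracketWithin.trans VectorField.lieBracketWithin_univ)
  have h4 : VectorField.mlieBracket (𝓡 5) (M := R5) V W (e (e.symm p)) =
      fderiv ℝ W p (V p) - fderiv ℝ V p (W p) := by
    rw [e.right_inv hp', h3]; rfl
  rw [← h1]
  exact dcoord_eq ((mfderiv_chart_mpullback he _ hx).trans h4) i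

/-- The bridge between the geometric integrability hypotheses and the formal bracket of the
connection. -/
lemma dcoordC_bracket {G : R5 → Matrix (Fin 5) (Fin 5) ℝ} (h : IsMetricOn G U)
    (X Y : Fin 5 → SmoothFn U) (hU : (U : Set R5) ⊆ e.target) (p : U) (i : Fin 5) :
    dcoordC e (e.symm p) i (((vectorField e X).bracket (vectorField e Y)).val (e.symm p)) =
      SmoothFn.eval p (h.coordMetric.leviCivita.bracket X Y i) := by
  have h1 : h.coordMetric.leviCivita.bracket X Y i =
      h.coordMetric.der X (Y i) - h.coordMetric.der Y (X i) := h.coordMetric.conn_sub_conn X Y i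
  rw [h1, map_sub, eval_der, eval_der, dcoordC_val]
  simp only [CVectorField.bracket, map_sub, map_add, vectorField]
  rw [dcoord_mlieBracket he (contDiffOn_reVec X) (contDiffOn_reVec Y) p.2 (hU p.2),
    dcoord_mlieBracket he (contDiffOn_imVec X) (contDiffOn_imVec Y) p.2 (hU p.2),
    dcoord_mlieBracket he (contDiffOn_reVec X) (contDiffOn_imVec Y) p.2 (hU p.2),
    dcoord_mlieBracket he (contDiffOn_imVec X) (contDiffOn_reVec Y) p.2 (hU p.2)]
  simp only [fderiv_reVec, fderiv_imVec]
  apply Complex.ext <;> simp <;> ring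

end Fields

/-! ### Linear algebra of a totally null plane in dimension five -/

section LinearAlgebra

variable {k E : Type*} [Field k] [AddCommGroup E] [Module k E] [FiniteDimensional k E]
  {B : LinearMap.BilinForm k E} (hB : B.Nondegenerate) (hsymm : ∀ v w, B v w = B w v)
  {s t : E} (hst : LinearIndependent k ![s, t])
include hB hsymm hst

lemma finrank_span_linearIndependent_pair :
    Module.finrank k (Submodule.span k {s, t}) = 2 := by
  have := finrank_span_eq_card hst
  rwa [Matrix.range_cons_cons_empty, Fintype.card_fin] at this

/-- Otherwise t^⊥ ⊆ s^⊥, and taking orthogonals again puts s in the line of t. -/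
lemma exists_dual_pair : ∃ a, B s a = 1 ∧ B t a = 0 := by
  have hrefl : B.IsRefl := fun v w h => by rw [hsymm, h]
  by_contra! hne
  have h1 : ∀ a, B t a = 0 → B s a = 0 := by
    intro a ha
    by_contra h0
    exact hne ((B s a)⁻¹ • a) (by simp [h0]) (by simp [ha])
  have h2 : s ∈ B.orthogonal (B.orthogonal (Submodule.span k {t})) := by
    intro a ha
    change B a s = 0
    rw [hsymm]
    exact h1 a (ha t (Submodule.mem_span_singleton_self t))
  rw [LinearMap.BilinForm.orthogonal_orthogonal hB hrefl, Submodule.mem_span_singleton] at h2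
  obtain ⟨c, hc⟩ := h2
  have h3 := LinearIndependent.pair_iff.1 hst 1 (-c) (by rw [← hc]; module)
  exact one_ne_zero h3.1

variable (hE : Module.finrank k E = 5) (hN : Submodule.span k {s, t} ≤
  B.orthogonal (Submodule.span k {s, t}))
include hE hN

/-- If N^⊥ consisted of null vectors, polarization would give N^⊥ ⊆ N^⊥⊥ = N, which is impossible
for dimensions 3 and 2. -/
lemma exists_orthogonal_ne_zero (h2 : (2 : k) ≠ 0) :
    ∃ u ∈ B.orthogonal (Submodule.span k {s, t}), B u u ≠ 0 := by
  have hrefl : B.IsRefl := fun v w h => by rw [hsymm, h]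
  by_contra! hne
  have h1 : B.orthogonal (Submodule.span k {s, t}) ≤
      B.orthogonal (B.orthogonal (Submodule.span k {s, t})) := by
    intro v hv w hw
    change B w v = 0
    have h3 := hne _ (Submodule.add_mem _ hv hw)
    simp only [map_add, LinearMap.add_apply, hne v hv, hne w hw, hsymm v w, zero_add, add_zero]
      at h3
    rw [← two_mul] at h3
    exact (mul_eq_zero.1 h3).resolve_left h2
  rw [LinearMap.BilinForm.orthogonal_orthogonal hB hrefl] at h1
  have h4 := Submodule.finrank_mono h1
  rw [LinearMap.BilinForm.finrank_orthogonal hB, hE,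
    finrank_span_linearIndependent_pair hB hsymm hst] at h4
  omega

variable {u : E} (hu : u ∈ B.orthogonal (Submodule.span k {s, t})) (huu : B u u ≠ 0)
include hu huu

/-- A non-null u in N^⊥ cannot lie in N, so N and u together fill the three dimensions of N^⊥. -/
lemma exists_eq_of_mem_orthogonal {v : E} (hv : v ∈ B.orthogonal (Submodule.span k {s, t})) :
    ∃ a b c : k, v = a • s + b • t + c • u := by
  have hlt : Submodule.span k {s, t} < Submodule.span k {s, t} ⊔ Submodule.span k {u} := by
    refine lt_of_le_of_ne le_sup_left fun h => huu ?_
    have : u ∈ Submodule.span k {s, t} := by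
      rw [h]; exact Submodule.mem_sup_right (Submodule.mem_span_singleton_self u)
    exact hu u this
  have hle : Submodule.span k {s, t} ⊔ Submodule.span k {u} ≤
      B.orthogonal (Submodule.span k {s, t}) :=
    sup_le hN ((Submodule.span_singleton_le_iff_mem _ _).2 hu)
  have heq := Submodule.eq_of_le_of_finrank_le hle (by
    have := Submodule.finrank_lt_finrank_of_lt hlt
    rw [LinearMap.BilinForm.finrank_orthogonal hB, hE]
    rw [finrank_span_linearIndependent_pair hB hsymm hst] at this ⊢
    omega)
  rw [← heq, Submodule.mem_sup] at hv
  obtain ⟨n, hn, w, hw, rfl⟩ := hv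
  obtain ⟨a, b, rfl⟩ := Submodule.mem_span_pair.1 hn
  obtain ⟨c, rfl⟩ := Submodule.mem_span_singleton.1 hw
  exact ⟨a, b, c, rfl⟩

/-- This justifies encoding membership in N by the three equations of `InNull`: on N^⊥, pairing with
u detects exactly the u-coefficient. -/
lemma mem_span_of_mem_orthogonal {v : E} (hv : v ∈ B.orthogonal (Submodule.span k {s, t}))
    (hvu : B v u = 0) : v ∈ Submodule.span k {s, t} := by
  obtain ⟨a, b, c, rfl⟩ := exists_eq_of_mem_orthogonal hB hsymm hst hE hN hu huu hv
  have hs : B s u = 0 := hu s (Submodule.subset_span (by simp))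
  have ht : B t u = 0 := hu t (Submodule.subset_span (by simp))
  have hc : c = 0 := by simpa [hs, ht, huu] using hvu
  rw [hc, zero_smul, add_zero]
  exact Submodule.mem_span_pair.2 ⟨a, b, rfl⟩

end LinearAlgebra

/-! ### From identities of functions to values at points -/

namespace SmoothFn

variable {U V : TopologicalSpace.Opens R5}

/-- Restriction of smooth functions to a smaller open set. -/
def restrict (h : U ≤ V) (f : SmoothFn V) : SmoothFn U :=
  ofFun (extendZero (f : V → ℂ)) (f.2.mono h)

lemma eval_restrict (h : U ≤ V) (f : SmoothFn V) (p : U) :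
    eval p (restrict h f) = eval ⟨p, h p.2⟩ f :=
  extendZero_eq_eval f ⟨p, h p.2⟩

lemma isOpen_eval_ne_zero (f : SmoothFn U) : IsOpen {p | ∃ hp : p ∈ U, eval ⟨p, hp⟩ f ≠ 0} := by
  have := (ContDiffOn.continuousOn f.2).isOpen_inter_preimage U.isOpen
    (isOpen_compl_singleton (x := (0 : ℂ)))
  have h : {p | ∃ hp : p ∈ U, eval ⟨p, hp⟩ f ≠ 0} =
      (U : Set R5) ∩ extendZero (f : U → ℂ) ⁻¹' {0}ᶜ := by
    refine Set.ext fun p => ⟨?_, ?_⟩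
    · rintro ⟨hp, h⟩
      exact ⟨hp, by simpa [extendZero_eq_eval f ⟨p, hp⟩] using h⟩
    · rintro ⟨hp, h⟩
      exact ⟨hp, by simpa [extendZero_eq_eval f ⟨p, hp⟩] using h⟩
  rw [h]
  exact this

end SmoothFn

section Evaluation

variable {M : Type*} [TopologicalSpace M] [ChartedSpace R5 M] [IsManifold (𝓡 5) ∞ M]
  (g : LorentzianMetric M) {e : OpenPartialHomeomorph M R5}
  (he : e ∈ IsManifold.maximalAtlas (𝓡 5) ∞ M)
  {U : TopologicalSpace.Opens R5} (hU : (U : Set R5) ⊆ e.target)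

/-- The value at a point of the complex vector field with given components in a chart. -/
def valueAt (e : OpenPartialHomeomorph M R5) (X : Fin 5 → SmoothFn U) (p : U) :
    CTangent (e.symm (p : R5)) :=
  ofCoordsC e p fun i => SmoothFn.eval p (X i)

include he hU

lemma dcoordC_valueAt (X : Fin 5 → SmoothFn U) (p : U) (i : Fin 5) :
    dcoordC e (e.symm (p : R5)) i (valueAt e X p) = SmoothFn.eval p (X i) :=
  dcoordC_ofCoordsC he (hU p.2) _ i

lemma isMetricOn_coordMatrix : IsMetricOn (g.coordMatrix e) U where
  contDiffOn i j := (contDiffOn_coordMatrix he g i j).mono hU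
  symm p _ i j := by simp only [LorentzianMetric.coordMatrix, Matrix.of_apply]; exact g.symm _ _ _
  det_ne_zero p hp h0 := by
    -- A kernel vector of the matrix would be a tangent vector orthogonal to everything, contrary to
    -- nondegeneracy.
    obtain ⟨v, hv, h⟩ := Matrix.exists_mulVec_eq_zero_iff.2 h0
    apply hv
    have h1 : ofCoordsC e p (fun i => (v i : ℂ)) = 0 := by
      refine (formC_nondegenerate g (e.symm p)).2 _ fun V => ?_
      rw [formC_eq_sum he g (hU hp)]
      refine Finset.sum_eq_zero fun i _ => ?_
      simp only [dcoordC_ofCoordsC he (hU hp)]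
      have h2 : ∑ j, (g.coordMatrix e p i j : ℂ) * (v j : ℂ) = 0 := by
        have := congrArg (fun r : ℝ => (r : ℂ)) (congrFun h i)
        simpa [Matrix.mulVec, dotProduct] using this
      rw [← mul_zero (dcoordC e (e.symm p) i V), ← h2, Finset.mul_sum]
      exact Finset.sum_congr rfl fun j _ => by ring
    ext i
    have h3 := dcoordC_ofCoordsC he (hU hp) (fun i => (v i : ℂ)) i
    rw [h1, map_zero] at h3
    exact_mod_cast h3.symm

lemma eval_form (h : IsMetricOn (g.coordMatrix e) U) (X Y : Fin 5 → SmoothFn U) (p : U) :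
    SmoothFn.eval p (h.coordMetric.leviCivita.form X Y) =
      g.formC (e.symm (p : R5)) (valueAt e X p) (valueAt e Y p) := by
  rw [formC_eq_sum he g (hU p.2)]
  change SmoothFn.eval p (h.coordMetric.form X Y) = _
  simp only [dcoordC_valueAt he hU, CoordMetric.form_apply, map_sum, map_mul,
    h.G_isComplexification _ _ p]
  exact Finset.sum_congr rfl fun i _ => Finset.sum_congr rfl fun j _ => by ring

lemma eval_weyl (h : IsMetricOn (g.coordMatrix e) U) (X Y Z W : Fin 5 → SmoothFn U) (p : U) :
    SmoothFn.eval p (h.coordMetric.leviCivita.weyl (Matrix.toBilin' h.rho) X Y Z W) =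
      g.weylC e (e.symm (p : R5)) (valueAt e X p) (valueAt e Y p) (valueAt e Z p)
        (valueAt e W p) := by
  simp only [LorentzianMetric.weylC, e.right_inv (hU p.2), dcoordC_valueAt he hU,
    CoordMetric.weyl_eq_sum, map_sum, map_mul, h.weyl_isComplexification _ _ _ _ p]

lemma eval_cotton (h : IsMetricOn (g.coordMatrix e) U) (X Y Z : Fin 5 → SmoothFn U) (p : U) :
    SmoothFn.eval p (h.coordMetric.leviCivita.cotton (Matrix.toBilin' h.rho) X Y Z) =
      g.cottonYorkC e (e.symm (p : R5)) (valueAt e X p) (valueAt e Y p) (valueAt e Z p) := by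
  simp only [LorentzianMetric.cottonYorkC, e.right_inv (hU p.2), dcoordC_valueAt he hU,
    CoordMetric.cotton_eq_sum, map_sum, map_mul, h.cotton_isComplexification _ _ _ p]

lemma val_vectorField (X : Fin 5 → SmoothFn U) (p : U) :
    (vectorField e X).val (e.symm (p : R5)) = valueAt e X p :=
  ext_dcoordC he (hU p.2) fun i => by
    rw [dcoordC_vectorField he X hU, dcoordC_valueAt he hU]

/-- Integrability is assumed for sections over open subsets of the manifold; it is applied to the
fields with these components on the preimage of `U`. -/
lemma valueAt_bracket_mem (h : IsMetricOn (g.coordMatrix e) U)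
    {D : ∀ x : M, Submodule ℂ (CTangent x)} (hD : IsIntegrable D) {X Y : Fin 5 → SmoothFn U}
    (hX : ∀ p : U, valueAt e X p ∈ D (e.symm (p : R5)))
    (hY : ∀ p : U, valueAt e Y p ∈ D (e.symm (p : R5))) (p : U) :
    valueAt e (h.coordMetric.leviCivita.bracket X Y) p ∈ D (e.symm (p : R5)) := by
  have key : ∀ {X : Fin 5 → SmoothFn U}, (∀ p : U, valueAt e X p ∈ D (e.symm (p : R5))) →
      ∀ x ∈ e.source ∩ e ⁻¹' U, (vectorField e X).val x ∈ D x := by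
    rintro X hX x ⟨hx, hx'⟩
    obtain ⟨p, hp, rfl⟩ : ∃ p ∈ U, e.symm p = x := ⟨e x, hx', e.left_inv hx⟩
    rw [val_vectorField he hU X ⟨p, hp⟩]
    exact hX ⟨p, hp⟩
  have h1 := hD (e.source ∩ e ⁻¹' U) (e.isOpen_inter_preimage U.isOpen) (vectorField e X)
    (vectorField e Y) (smoothOn_vectorField he X) (smoothOn_vectorField he Y) (key hX) (key hY)
    (e.symm p) ⟨e.map_target (hU p.2), by
      rw [Set.mem_preimage, e.right_inv (hU p.2)]; exact p.2⟩
  convert h1 using 1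
  exact ext_dcoordC he (hU p.2) fun i => by
    rw [dcoordC_bracket he h X Y hU, dcoordC_valueAt he hU]

lemma exists_components {s : CVectorField M} {V : Set M} (hV : IsOpen V) (hs : s.SmoothOn V)
    (hUV : (U : Set R5) ⊆ e.symm ⁻¹' V) :
    ∃ X : Fin 5 → SmoothFn U, ∀ p : U, valueAt e X p = s.val (e.symm (p : R5)) := by
  have hsub : (U : Set R5) ⊆ e.target ∩ e.symm ⁻¹' V := fun p hp => ⟨hU hp, hUV hp⟩
  have key : ∀ i, ContDiffOn ℝ ∞ (fun p => dcoordC e (e.symm p) i (s.val (e.symm p))) U := by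
    intro i
    have h1 : ∀ {W : ∀ x : M, TangentSpace (𝓡 5) x}, ContMDiffOn (𝓡 5) (𝓡 5).tangent ∞
        (fun x => (⟨x, W x⟩ : TangentBundle (𝓡 5) M)) V →
        ContDiffOn ℝ ∞ (fun p => (dcoord e (e.symm p) i (W (e.symm p)) : ℂ)) U := by
      intro W hW
      have h2 := (contDiffOn_piLp 2).1 ((contDiffOn_mpullback_chart_symm he hV hW).mono hsub) i
      refine Complex.ofRealCLM.contDiff.comp_contDiffOn (h2.congr fun p hp => ?_)
      exact dcoord_eq (mfderiv_chart_eq_mpullback_symm he W (hU hp)) i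
    refine ((h1 hs.1).add ((contDiffOn_const (c := Complex.I)).mul (h1 hs.2))).congr fun p hp => ?_
    exact dcoordC_val e s (e.symm p) i
  refine ⟨fun i => SmoothFn.ofFun _ (key i), fun p => ext_dcoordC he (hU p.2) fun i => ?_⟩
  rw [dcoordC_valueAt he hU, SmoothFn.eval_ofFun]

end Evaluation

/-! ### Smooth adapted frames -/

section Frame

variable {M : Type*} [TopologicalSpace M] [ChartedSpace R5 M] [IsManifold (𝓡 5) ∞ M]
  (g : LorentzianMetric M) {e : OpenPartialHomeomorph M R5}
  (he : e ∈ IsManifold.maximalAtlas (𝓡 5) ∞ M)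
  {N : ∀ x : M, Submodule ℂ (CTangent x)}

/-- The complex vector field with constant components in a chart. -/
def constField (U : TopologicalSpace.Opens R5) (v : Fin 5 → ℂ) : Fin 5 → SmoothFn U :=
  fun i => algebraMap ℂ (SmoothFn U) (v i)

include he

lemma valueAt_constField {U : TopologicalSpace.Opens R5} (hU : (U : Set R5) ⊆ e.target) (p : U)
    (V : CTangent (e.symm (p : R5))) :
    valueAt e (constField U fun i => dcoordC e (e.symm (p : R5)) i V) p = V :=
  ofCoordsC_dcoordC he (hU p.2) V

/-- Near every point of a chart there is a smooth frame `s, t` of the null distribution `N` and a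
non-null section `u` of `N^⊥`. -/
lemma exists_adapted_frame (hN : g.IsAlmostNullStructure N) {p₀ : R5} (hp₀ : p₀ ∈ e.target) :
    ∃ U : TopologicalSpace.Opens R5, p₀ ∈ U ∧ (U : Set R5) ⊆ e.target ∧
      ∃ s t u : Fin 5 → SmoothFn U, ∀ p : U,
        LinearIndependent ℂ ![valueAt e s p, valueAt e t p] ∧
        N (e.symm (p : R5)) = Submodule.span ℂ {valueAt e s p, valueAt e t p} ∧
        valueAt e u p ∈ g.perp N (e.symm (p : R5)) ∧
        g.formC (e.symm (p : R5)) (valueAt e u p) (valueAt e u p) ≠ 0 := by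
  obtain ⟨V, hV, hx₀, s', t', hs', ht', hst'⟩ := hN.subbundle (e.symm p₀)
  let U₁ : TopologicalSpace.Opens R5 := ⟨e.target ∩ e.symm ⁻¹' V, e.isOpen_inter_preimage_symm hV⟩
  have hU₁ : (U₁ : Set R5) ⊆ e.target := Set.inter_subset_left
  let q : U₁ := ⟨p₀, hp₀, hx₀⟩
  obtain ⟨s, hs⟩ := exists_components he hU₁ hV hs' Set.inter_subset_right
  obtain ⟨t, ht⟩ := exists_components he hU₁ hV ht' Set.inter_subset_right
  have hst : ∀ p : U₁, LinearIndependent ℂ ![valueAt e s p, valueAt e t p] ∧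
      N (e.symm (p : R5)) = Submodule.span ℂ {valueAt e s p, valueAt e t p} := by
    intro p
    rw [hs, ht]
    exact hst' _ p.2.2
  obtain ⟨hli, hNq⟩ := hst q
  have hnd := formC_nondegenerate g (e.symm (q : R5))
  have hsy := formC_symm g (e.symm (q : R5))
  -- At the base point, a and b are dual to s and t, and w is a non-null vector of N^⊥. All three
  -- are extended with constant components.
  obtain ⟨a, ha₁, ha₂⟩ := exists_dual_pair hnd hsy hli
  obtain ⟨b, hb₁, hb₂⟩ := exists_dual_pair hnd hsy (LinearIndependent.pair_symm_iff.1 hli)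
  have hnull := hN.totallyNull (e.symm (q : R5))
  rw [LorentzianMetric.perp, hNq] at hnull
  obtain ⟨w, hw, hww⟩ := exists_orthogonal_ne_zero hnd hsy hli (finrank_cTangent _) hnull
    two_ne_zero
  have hsw : g.formC _ (valueAt e s q) w = 0 := hw _ (Submodule.subset_span (by simp))
  have htw : g.formC _ (valueAt e t q) w = 0 := hw _ (Submodule.subset_span (by simp))
  have h := isMetricOn_coordMatrix g he hU₁
  let L := h.coordMetric.leviCivita
  let A := constField U₁ fun i => dcoordC e (e.symm (q : R5)) i a
  let B := constField U₁ fun i => dcoordC e (e.symm (q : R5)) i b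
  let W := constField U₁ fun i => dcoordC e (e.symm (q : R5)) i w
  have hA : valueAt e A q = a := valueAt_constField he hU₁ q a
  have hB : valueAt e B q = b := valueAt_constField he hU₁ q b
  have hW : valueAt e W q = w := valueAt_constField he hU₁ q w
  -- Cramer's rule without division: W is corrected by A and B so as to be orthogonal to s and t
  -- throughout. At the base point the determinant is 1 and both corrections vanish, so u has value
  -- w there.
  let u : Fin 5 → SmoothFn U₁ := (L.form s A * L.form t B - L.form s B * L.form t A) • W
    - (L.form s W * L.form t B - L.form t W * L.form s B) • A
    - (L.form s A * L.form t W - L.form t A * L.form s W) • B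
  have hsu : L.form s u = 0 := by
    simp only [u, map_sub, map_smul, smul_eq_mul]; ring
  have htu : L.form t u = 0 := by
    simp only [u, map_sub, map_smul, smul_eq_mul]; ring
  have huq : valueAt e u q = w := by
    refine ext_dcoordC he hp₀ fun i => ?_
    have e1 : ∀ X Y, SmoothFn.eval q (L.form X Y) = _ := fun X Y => eval_form g he hU₁ h X Y q
    rw [dcoordC_valueAt he hU₁ u q, ← hW, dcoordC_valueAt he hU₁ W q]
    simp [u, e1, hA, hB, hW, ha₁, ha₂, hb₁, hb₂, hsw, htw]
  -- Shrink to the open set where g(u,u) ≠ 0.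
  let U : TopologicalSpace.Opens R5 :=
    ⟨_, SmoothFn.isOpen_eval_ne_zero (L.form u u)⟩
  have hUU : U ≤ U₁ := fun p hp => hp.1
  have hval : ∀ (X : Fin 5 → SmoothFn U₁) (p : U),
      valueAt e (fun i => SmoothFn.restrict hUU (X i)) p = valueAt e X ⟨p, hUU p.2⟩ := by
    intro X p
    simp only [valueAt, SmoothFn.eval_restrict]
  refine ⟨U, ⟨q.2, ?_⟩, fun p hp => hU₁ (hUU hp), fun i => SmoothFn.restrict hUU (s i),
    fun i => SmoothFn.restrict hUU (t i), fun i => SmoothFn.restrict hUU (u i), fun p => ?_⟩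
  · rw [eval_form g he hU₁ h u u q, huq]
    exact hww
  · rw [hval, hval, hval]
    obtain ⟨h1, h2⟩ := hst ⟨p, hUU p.2⟩
    refine ⟨h1, h2, ?_, ?_⟩
    · rw [LorentzianMetric.perp, h2]
      intro n hn
      obtain ⟨c, d, rfl⟩ := Submodule.mem_span_pair.1 hn
      change g.formC _ _ _ = 0
      have e1 := eval_form g he hU₁ h s u ⟨p, hUU p.2⟩
      have e2 := eval_form g he hU₁ h t u ⟨p, hUU p.2⟩
      rw [show h.coordMetric.leviCivita.form s u = 0 from hsu, map_zero] at e1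
      rw [show h.coordMetric.leviCivita.form t u = 0 from htu, map_zero] at e2
      rw [map_add, map_smul, map_smul, LinearMap.add_apply, LinearMap.smul_apply,
        LinearMap.smul_apply, ← e1, ← e2, smul_zero, smul_zero, add_zero]
    · obtain ⟨_, h3⟩ := p.2
      rwa [eval_form g he hU₁ h u u] at h3

end Frame

/-! ### Multilinearity of the Cotton tensor and conclusion -/

section Linear

variable {M : Type*} [TopologicalSpace M] [ChartedSpace R5 M] [IsManifold (𝓡 5) ∞ M]
  (g : LorentzianMetric M) (e : OpenPartialHomeomorph M R5) (x : M)

lemma cottonYorkC_linear_left (a b c : ℂ) (X₁ X₂ X₃ Y Z : CTangent x) :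
    g.cottonYorkC e x (a • X₁ + b • X₂ + c • X₃) Y Z = a * g.cottonYorkC e x X₁ Y Z
      + b * g.cottonYorkC e x X₂ Y Z + c * g.cottonYorkC e x X₃ Y Z := by
  simp only [LorentzianMetric.cottonYorkC, Finset.mul_sum, ← Finset.sum_add_distrib]
  refine Finset.sum_congr rfl fun i _ => Finset.sum_congr rfl fun j _ =>
    Finset.sum_congr rfl fun k _ => ?_
  simp only [map_add, map_smul, smul_eq_mul]
  ring

lemma cottonYorkC_linear_mid (a b c : ℂ) (X Y₁ Y₂ Y₃ Z : CTangent x) :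
    g.cottonYorkC e x X (a • Y₁ + b • Y₂ + c • Y₃) Z = a * g.cottonYorkC e x X Y₁ Z
      + b * g.cottonYorkC e x X Y₂ Z + c * g.cottonYorkC e x X Y₃ Z := by
  simp only [LorentzianMetric.cottonYorkC, Finset.mul_sum, ← Finset.sum_add_distrib]
  refine Finset.sum_congr rfl fun i _ => Finset.sum_congr rfl fun j _ =>
    Finset.sum_congr rfl fun k _ => ?_
  simp only [map_add, map_smul, smul_eq_mul]
  ring

lemma cottonYorkC_linear_right (a b c : ℂ) (X Y Z₁ Z₂ Z₃ : CTangent x) :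
    g.cottonYorkC e x X Y (a • Z₁ + b • Z₂ + c • Z₃) = a * g.cottonYorkC e x X Y Z₁
      + b * g.cottonYorkC e x X Y Z₂ + c * g.cottonYorkC e x X Y Z₃ := by
  simp only [LorentzianMetric.cottonYorkC, Finset.mul_sum, ← Finset.sum_add_distrib]
  refine Finset.sum_congr rfl fun i _ => Finset.sum_congr rfl fun j _ =>
    Finset.sum_congr rfl fun k _ => ?_
  simp only [map_add, map_smul, smul_eq_mul]
  ring

lemma cottonYorkC_swap (X Y Z : CTangent x) :
    g.cottonYorkC e x X Y Z = - g.cottonYorkC e x X Z Y := by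
  simp only [LorentzianMetric.cottonYorkC, ← Finset.sum_neg_distrib]
  refine Finset.sum_congr rfl fun i _ => ?_
  rw [Finset.sum_comm]
  refine Finset.sum_congr rfl fun j _ => Finset.sum_congr rfl fun k _ => ?_
  simp only [Coord.cottonYork]
  push_cast
  ring

lemma cottonYorkC_self (X Y : CTangent x) : g.cottonYorkC e x X Y Y = 0 := by
  have := cottonYorkC_swap g e x X Y Y
  linear_combination this / 2

end Linear

section Main

variable {M : Type*} [TopologicalSpace M] [ChartedSpace R5 M] [IsManifold (𝓡 5) ∞ M]
  (g : LorentzianMetric M) {e : OpenPartialHomeomorph M R5}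
  {N : ∀ x : M, Submodule ℂ (CTangent x)}

lemma mem_perp_iff {x : M} {s t : CTangent x} (hN : N x = Submodule.span ℂ {s, t})
    (V : CTangent x) : V ∈ g.perp N x ↔ g.formC x V s = 0 ∧ g.formC x V t = 0 := by
  rw [LorentzianMetric.perp, hN]
  constructor
  · intro h
    rw [formC_symm g x V s, formC_symm g x V t]
    exact ⟨h s (Submodule.subset_span (by simp)), h t (Submodule.subset_span (by simp))⟩
  · rintro ⟨h1, h2⟩ n hn
    obtain ⟨c, d, rfl⟩ := Submodule.mem_span_pair.1 hn
    change g.formC _ _ _ = 0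
    rw [formC_symm]
    simp [h1, h2]

/-- The Cotton tensor on an adapted frame, after evaluation at a point. -/
lemma cottonYorkC_frame (hN : g.IsAlmostNullStructure N) (hint : IsIntegrable N)
    (hint' : IsIntegrable (g.perp N)) (hC : g.IsAlgebraicallySpecial N)
    (he : e ∈ IsManifold.maximalAtlas (𝓡 5) ∞ M) {U : TopologicalSpace.Opens R5}
    (hU : (U : Set R5) ⊆ e.target) {s t u : Fin 5 → SmoothFn U}
    (hframe : ∀ p : U, LinearIndependent ℂ ![valueAt e s p, valueAt e t p] ∧
        N (e.symm (p : R5)) = Submodule.span ℂ {valueAt e s p, valueAt e t p} ∧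
        valueAt e u p ∈ g.perp N (e.symm (p : R5)) ∧
        g.formC (e.symm (p : R5)) (valueAt e u p) (valueAt e u p) ≠ 0) (q : U) :
    (∀ f, f = s ∨ f = t → g.cottonYorkC e (e.symm (q : R5)) (valueAt e f q) (valueAt e s q)
      (valueAt e t q) = 0) ∧
    ∀ (a : CTangent (e.symm (q : R5))) (b), b = s ∨ b = t →
      g.formC _ a (valueAt e t q) * g.cottonYorkC e (e.symm (q : R5)) (valueAt e s q)
        (valueAt e b q) (valueAt e u q) =
      g.formC _ a (valueAt e s q) * g.cottonYorkC e (e.symm (q : R5)) (valueAt e t q)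
        (valueAt e b q) (valueAt e u q) := by
  have h := isMetricOn_coordMatrix g he hU
  have hsN : ∀ p : U, valueAt e s p ∈ N (e.symm (p : R5)) := fun p => by
    rw [(hframe p).2.1]; exact Submodule.subset_span (by simp)
  have htN : ∀ p : U, valueAt e t p ∈ N (e.symm (p : R5)) := fun p => by
    rw [(hframe p).2.1]; exact Submodule.subset_span (by simp)
  -- Vanishing of a smooth function is pointwise, so the formal conditions `InPerp` and `InNull`
  -- mean membership in N^⊥ and N at every point of `U`.
  have hperp : ∀ V : Fin 5 → SmoothFn U, h.coordMetric.leviCivita.InPerp s t V ↔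
      ∀ p : U, valueAt e V p ∈ g.perp N (e.symm (p : R5)) := by
    intro V
    constructor
    · rintro ⟨h1, h2⟩ p
      rw [mem_perp_iff g (hframe p).2.1, ← eval_form g he hU h, ← eval_form g he hU h, h1, h2,
        map_zero]
      exact ⟨rfl, rfl⟩
    · intro hV
      constructor <;> refine SmoothFn.ext_eval fun p => ?_ <;>
        rw [eval_form g he hU h, map_zero]
      exacts [((mem_perp_iff g (hframe p).2.1 _).1 (hV p)).1,
        ((mem_perp_iff g (hframe p).2.1 _).1 (hV p)).2]
  have hspan : ∀ p : U, Submodule.span ℂ {valueAt e s p, valueAt e t p} ≤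
      (g.formC (e.symm (p : R5))).orthogonal
        (Submodule.span ℂ {valueAt e s p, valueAt e t p}) := by
    intro p
    have := hN.totallyNull (e.symm (p : R5))
    rwa [LorentzianMetric.perp, (hframe p).2.1] at this
  have hu : ∀ p : U, valueAt e u p ∈ (g.formC (e.symm (p : R5))).orthogonal
        (Submodule.span ℂ {valueAt e s p, valueAt e t p}) := by
    intro p
    have := (hframe p).2.2.1
    rwa [LorentzianMetric.perp, (hframe p).2.1] at this
  have hnull : ∀ V : Fin 5 → SmoothFn U, h.coordMetric.leviCivita.InNull s t u V ↔
      ∀ p : U, valueAt e V p ∈ N (e.symm (p : R5)) := by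
    intro V
    rw [LeviCivitaAlgebra.InNull, hperp]
    constructor
    · rintro ⟨h1, h2⟩ p
      have h3 := h1 p
      rw [LorentzianMetric.perp, (hframe p).2.1] at h3
      rw [(hframe p).2.1]
      refine mem_span_of_mem_orthogonal (formC_nondegenerate g _) (formC_symm g _) (hframe p).1
        (finrank_cTangent _) (hspan p) (hu p) (hframe p).2.2.2 h3 ?_
      rw [← eval_form g he hU h, h2, map_zero]
    · intro hV
      refine ⟨fun p => hN.totallyNull _ (hV p), SmoothFn.ext_eval fun p => ?_⟩
      rw [eval_form g he hU h, map_zero]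
      exact (hframe p).2.2.1 _ (hV p)
  have hF : h.coordMetric.leviCivita.IsNullFrame s t u := by
    have hup : ∀ p : U, valueAt e u p ∈ g.perp N (e.symm (p : R5)) := fun p => (hframe p).2.2.1
    refine ⟨(hnull s).2 hsN, (hnull t).2 htN, (hperp u).2 hup, (hnull _).2 ?_, (hperp _).2 ?_,
      (hperp _).2 ?_⟩
    · exact valueAt_bracket_mem g he hU h hint hsN htN
    · exact valueAt_bracket_mem g he hU h hint' (fun p => hN.totallyNull _ (hsN p)) hup
    · exact valueAt_bracket_mem g he hU h hint' (fun p => hN.totallyNull _ (htN p)) hup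
  obtain ⟨c1, c2⟩ := hF.cotton_eq_zero (P := Matrix.toBilin' h.rho)
    (fun X Y => by
      simp only [Matrix.toBilin'_apply]
      rw [Finset.sum_comm]
      refine Finset.sum_congr rfl fun i _ => Finset.sum_congr rfl fun j _ => ?_
      rw [h.rho_symm]; ring)
    (fun X Y Z W hX hY hZ => SmoothFn.ext_eval fun p => by
      rw [eval_weyl g he hU h, map_zero]
      exact hC e he _ (e.map_target (hU p.2)) _ ((hperp X).1 hX p) _ ((hperp Y).1 hY p) _
        ((hnull Z).1 hZ p) _)
  refine ⟨fun f hf => ?_, fun a b hb => ?_⟩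
  -- The factor g(u,u) is cancelled after evaluation, in the field ℂ, since the ring of functions
  -- may have zero divisors.
  · have := congrArg (SmoothFn.eval q) (c1 f hf)
    rw [map_mul, map_zero, eval_form g he hU h, eval_cotton g he hU h] at this
    exact (mul_eq_zero.1 this).resolve_left (hframe q).2.2.2
  -- The formal relation concerns vector fields, so the given vector is extended with constant
  -- components.
  · obtain ⟨A, hA⟩ : ∃ A, valueAt e A q = a := ⟨_, valueAt_constField he hU q a⟩
    have e1 := eval_form g he hU h A t q
    have e2 := eval_form g he hU h A s q
    have key := congrArg (SmoothFn.eval q) (c2 A b hb)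
    rw [hA] at e1 e2
    rw [map_mul, map_mul] at key
    have e3 := eval_cotton g he hU h s b u q
    have e4 := eval_cotton g he hU h t b u q
    exact (congrArg₂ (· * ·) e1.symm e3.symm).trans (key.trans (congrArg₂ (· * ·) e2 e4))

lemma cottonYorkC_eq_zero_of_frame {x : M} {s t u : CTangent x}
    (h : ∀ f, f = s ∨ f = t → g.cottonYorkC e x f s t = 0 ∧ g.cottonYorkC e x f s u = 0 ∧
      g.cottonYorkC e x f t u = 0) (x₁ x₂ x₃ y₁ y₂ y₃ z₁ z₂ : ℂ) :
    g.cottonYorkC e x (z₁ • s + z₂ • t) (x₁ • s + x₂ • t + x₃ • u) (y₁ • s + y₂ • t + y₃ • u)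
      = 0 := by
  have key : ∀ f, f = s ∨ f = t → g.cottonYorkC e x f (x₁ • s + x₂ • t + x₃ • u)
      (y₁ • s + y₂ • t + y₃ • u) = 0 := by
    intro f hf
    obtain ⟨h1, h2, h3⟩ := h f hf
    rw [cottonYorkC_linear_mid]
    simp only [cottonYorkC_linear_right, cottonYorkC_self]
    rw [cottonYorkC_swap g e x f t s, cottonYorkC_swap g e x f u s,
      cottonYorkC_swap g e x f u t, h1, h2, h3]
    ring
  have := cottonYorkC_linear_left g e x z₁ z₂ 0 s t 0 (x₁ • s + x₂ • t + x₃ • u)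
    (y₁ • s + y₂ • t + y₃ • u)
  rw [smul_zero, add_zero] at this
  rw [this, key s (Or.inl rfl), key t (Or.inr rfl)]
  ring

/-- The pointwise linear algebra that reduces the vanishing of the Cotton tensor to a frame. -/
lemma cottonYorkC_eq_zero_of_span {x : M} {s t u : CTangent x}
    (hN : g.IsAlmostNullStructure N) (hli : LinearIndependent ℂ ![s, t])
    (hNx : N x = Submodule.span ℂ {s, t}) (hu : u ∈ g.perp N x) (huu : g.formC x u u ≠ 0)
    (h1 : ∀ f, f = s ∨ f = t → g.cottonYorkC e x f s t = 0)
    (h2 : ∀ a b, b = s ∨ b = t → g.formC x a t * g.cottonYorkC e x s b u =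
      g.formC x a s * g.cottonYorkC e x t b u)
    {X Y Z : CTangent x} (hX : X ∈ g.perp N x) (hY : Y ∈ g.perp N x) (hZ : Z ∈ N x) :
    g.cottonYorkC e x Z X Y = 0 := by
  have hnd := formC_nondegenerate g x
  have hsy := formC_symm g x
  have hnull := hN.totallyNull x
  rw [LorentzianMetric.perp, hNx] at hnull hu hX hY
  rw [hNx] at hZ
  -- Pairing with the vector dual to s isolates A(t, ·, u), and with the one dual to t isolates A(s,
  -- ·, u).
  obtain ⟨a, ha₁, ha₂⟩ := exists_dual_pair hnd hsy hli
  obtain ⟨b, hb₁, hb₂⟩ := exists_dual_pair hnd hsy (LinearIndependent.pair_symm_iff.1 hli)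
  have h3 : ∀ c, c = s ∨ c = t → g.cottonYorkC e x t c u = 0 := by
    intro c hc
    have := h2 a c hc
    rw [hsy a s, hsy a t, ha₁, ha₂, zero_mul, one_mul] at this
    exact this.symm
  have h4 : ∀ c, c = s ∨ c = t → g.cottonYorkC e x s c u = 0 := by
    intro c hc
    have := h2 b c hc
    rw [hsy b s, hsy b t, hb₁, hb₂, zero_mul, one_mul] at this
    exact this
  obtain ⟨x₁, x₂, x₃, rfl⟩ := exists_eq_of_mem_orthogonal hnd hsy hli (finrank_cTangent x) hnull hu
    huu hX
  obtain ⟨y₁, y₂, y₃, rfl⟩ := exists_eq_of_mem_orthogonal hnd hsy hli (finrank_cTangent x) hnull hu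
    huu hY
  obtain ⟨z₁, z₂, rfl⟩ := Submodule.mem_span_pair.1 hZ
  refine cottonYorkC_eq_zero_of_frame g (fun f hf => ⟨h1 f hf, ?_⟩) ..
  rcases hf with rfl | rfl
  · exact ⟨h4 _ (Or.inl rfl), h4 _ (Or.inr rfl)⟩
  · exact ⟨h3 _ (Or.inl rfl), h3 _ (Or.inr rfl)⟩

end Main

end

theorem mainTheorem2 {M : Type*} [TopologicalSpace M] [ChartedSpace R5 M]
    [IsManifold (𝓡 5) ∞ M] (g : LorentzianMetric M)
    (N : ∀ x : M, Submodule ℂ (CTangent x))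
    (K : ∀ x : M, Submodule ℝ (TangentSpace (𝓡 5) x))
    (hNK : g.IsOpticalStructure N K) (hC : g.IsAlgebraicallySpecial N) :
    ∀ e ∈ IsManifold.maximalAtlas (𝓡 5) ∞ M, ∀ x ∈ e.source,
      ∀ X ∈ g.perp N x, ∀ Y ∈ g.perp N x, ∀ Z ∈ N x,
        g.cottonYorkC e x Z X Y = 0 := by
  intro e he x hx X hX Y hY Z hZ
  obtain ⟨p, hp, rfl⟩ : ∃ p ∈ e.target, e.symm p = x := ⟨e x, e.map_source hx, e.left_inv hx⟩
  have hN := hNK.almostOptical.almostNull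
  obtain ⟨U, hpU, hU, s, t, u, hframe⟩ := exists_adapted_frame g he hN hp
  obtain ⟨hli, hNp, hu, huu⟩ := hframe ⟨p, hpU⟩
  obtain ⟨h1, h2⟩ := cottonYorkC_frame g hN hNK.integrable hNK.integrable_perp hC he hU hframe
    ⟨p, hpU⟩
  refine cottonYorkC_eq_zero_of_span g hN hli hNp hu huu ?_ ?_ hX hY hZ
  · rintro f (rfl | rfl)
    exacts [h1 s (Or.inl rfl), h1 t (Or.inr rfl)]
  · rintro a b (rfl | rfl)
    exacts [h2 a s (Or.inl rfl), h2 a t (Or.inr rfl)]
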